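/- **Theorem (Validity of OciorACOOL).** Let $t\ge 1$, $n\ge 3t+1$, let $k\ge 1$ be an integer equal to $t/3$ (rounded up or down if necessary; any $1\le k\le\lceil t/3\rceil$ is allowed), and let $F\subseteq[n]$, $|F|\le t$, be the set of dishonest nodes. Fix an $(n,k)$ error correction code: an encoder $w\mapsto(y_1(w),\dots,y_n(w))$ from $\Sigma^k$ to $\Sigma^n$ and a decoder that returns $w$ from any $n'\le n$ observed symbols of which $e$ are wrong, provided $2e+k\le n'$. Consider any execution of the protocol OciorACOOL below in which all honest nodes input the same value $w$. Then: 1. every honest node eventually outputs $w$; 2. no honest node ever sets one of the success indicators $s^{[1]},s^{[2]}$ or the vote $v$ to $0$, in either of $\mathrm{BUA}[1]$, $\mathrm{BUA}[2]$; 3. every input that an honest node passes to $\mathrm{BUA}[2]$ equals $w$; 4. ABBA outputs $1$: some honest node obtains the output $1$ from ABBA, and no honest node obtains the output $0$. *Model.* Asynchronous network with authenticated channels: a message sent between honest nodes is delayed arbitrarily, but is eventually received unless the receiver terminates first; dishonest nodes send arbitrary messages at any time. A node reacts to an external event (its input, the receipt of a message, an output of ABBA) by executing its enabled "upon" rules,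 in any order, until none is enabled or it terminates, and then takes the next event. Each rule is executed once per event it describes; only the first message of a given kind from a given node counts (except that $\mathrm{READY}$ messages are counted by sender and value); outputting ends all activity of a node. ABBA is an asynchronous binary agreement with: all outputs of honest nodes agree; if no honest node ever inputs a value other than $v$, then honest nodes output only $v$; if every honest node gives an input and none of them terminates, then every honest node obtains an output. *$\mathrm{BUA}[q]$, $q\in\{1,2\}$, at Node $i$* (all variables initially $\bot$ or empty). - On input $u$: send $\mathrm{SYMBOL}_q(y_j(u),y_i(u))$ to every Node $j$. - On $\mathrm{SYMBOL}_q(a,b)$ from $j$: deliver it to the main protocol; once an input $u$ is present, put $j$ into $L_1$ if $(a,b)=(y_i(u),y_j(u))$, otherwise into $L_0$. - If $s^{[1]}=\bot$: set $s^{[1]}=1$ if $|L_1|\ge n-t$; set $s^{[1]}=0$ if $|L_0|\ge t+1$; send the value to all. Let $S^{[1]}_b$ be the set of nodes from which the value $b$ was received. - If $s^{[2]}=\bot$: set $s^{[2]}=0$ if $s^{[1]}=0$ or $|S^{[1]}_0\cup L_0|\ge t+1$; set $s^{[2]}=1$ if $s^{[1]}=1$ and $|S^{[1]}_1\cap L_1|\ge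 n-t$; send the value to all. Let $S^{[2]}_b$ be the set of nodes from which $b$ was received. - Set $v=1$ if $|S^{[2]}_1|\ge n-t$, and $v=0$ if $|S^{[2]}_0|\ge t+1$; then deliver the current triple $[u,s^{[2]},v]$ (with $u=\bot$ if there is no input). *OciorACOOL at Node $i$* (bars and tildes mark the variables of $\mathrm{BUA}[1]$ and $\mathrm{BUA}[2]$; $\tilde M$ is initially $\bot$). - Pass the input $w_i$ to $\mathrm{BUA}[1]$. - Collect at most one symbol per node $j$ in $\bar\omega$: either $y$ from $\mathrm{NEWSYMBOL}(y)$ sent by $j$, or $b$ from a delivered $\mathrm{SYMBOL}_1(a,b)$ of a node $j\in\bar S^{[1]}_1$. After each addition, unless this has succeeded before: if $|\bar\omega|\ge k+t$, decode $\bar\omega$ to $M$; if at least $k+t$ symbols of $\bar\omega$ agree with the codeword of $M$, set $\tilde M=M$ (success). - Let $Y[y]$ be the set of nodes $j$ with a delivered $\mathrm{SYMBOL}_1(y,\cdot)$. If $|Y[y]\cup\bar S^{[2]}_0|\ge n-t$, $|Y[y]|\ge n-2t$, $\bar s^{[1]}\ne 1$ for some $y$, and no $\mathrm{NEWSYMBOL}$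 was sent yet, send $\mathrm{NEWSYMBOL}(y)$ to all. - If $\mathrm{BUA}[2]$ has no input: if $\bar s^{[2]}=1$, set $\tilde M=w_i$ and pass $w_i$ to $\mathrm{BUA}[2]$; if $\tilde M\ne\bot$, pass $\tilde M$ to $\mathrm{BUA}[2]$. - If ABBA has no input: if $\mathrm{BUA}[2]$ delivered a triple with vote $\tilde v$, input $\tilde v$ to ABBA; if $\bar v=0$ or $\bar s^{[2]}=0$, input $0$ to ABBA. - When ABBA outputs $v$, send $\mathrm{READY}(v)$ to all. On $\mathrm{READY}(v)$ from $t+1$ nodes, send $\mathrm{READY}(v)$ to all if no $\mathrm{READY}$ was sent yet. On $\mathrm{READY}(v)$ from $2t+1$ nodes, set $v_o=v$ (once); if $v_o=0$, output $\bot$ and terminate. - When $v_o=1$ is set: if $\mathrm{BUA}[2]$ has delivered a triple $[u,1,v]$, output $u$ and terminate. Otherwise wait until, for some $y$, at least $t+1$ nodes $j\in\tilde S^{[2]}_1$ have a delivered $\mathrm{SYMBOL}_2(y,\cdot)$; send $\mathrm{CORRECTSYMBOL}(y)$ to all; wait until a message has been decoded from $\omega$ (next rule), output it and terminate. - Until a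 message has been decoded, collect at most one symbol per node $j$ in $\omega$: either $y$ from $\mathrm{CORRECTSYMBOL}(y)$ sent by $j$, or $b$ from a delivered $\mathrm{SYMBOL}_2(a,b)$ of a node $j\in\tilde S^{[2]}_1$. After each addition, decode by the same test as for $\bar\omega$. -/

import Mathlib

noncomputable section

namespace ACOOL

/-! ### Error correction codes -/

open scoped Classical in
/-- An `(n, k)` error correction code over the alphabet `A`: an encoder `A^k → A^n` and a decoder
acting on the symbols observed so far (`none` marks a missing symbol), which returns the encoded
message as soon as `2 e + k ≤ n'`, where `n' ≤ n` is the number of observed symbols and `e` the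
number of wrong symbols among them. -/
structure ECC (A : Type*) (n k : ℕ) where
  enc : (Fin k → A) → Fin n → A
  dec : (Fin n → Option A) → (Fin k → A)
  dec_correct : ∀ (w : Fin k → A) (r : Fin n → Option A),
    2 * (Finset.univ.filter fun j => r j ≠ none ∧ r j ≠ some (enc w j)).card + k
      ≤ (Finset.univ.filter fun j => r j ≠ none).card →
    dec r = w

/-- Reed-Solomon encoding at the points `x`. -/
def rsEnc {K : Type*} [Field K] {n : ℕ} (k : ℕ) (x : Fin n → K) (w : Fin k → K) (j : Fin n) : K :=
  ∑ l : Fin k, w l * x j ^ (l : ℕ)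

theorem rsEnc_unique {K : Type*} [Field K] {n k : ℕ} {x : Fin n → K}
    (hx : Function.Injective x) {w w' : Fin k → K} (s : Finset (Fin n)) (hs : k ≤ s.card)
    (h : ∀ j ∈ s, rsEnc k x w j = rsEnc k x w' j) : w = w' := by
  obtain ⟨u, hu, huc⟩ := Finset.exists_subset_card_eq hs
  let e := u.equivFinOfCardEq huc
  have h0 : w - w' = 0 := by
    refine Matrix.eq_zero_of_forall_index_sum_mul_pow_eq_zero (f := fun a : Fin k => x (e.symm a))
      (fun a b hab => ?_) (fun a => ?_)
    · exact e.symm.injective (Subtype.ext (hx hab))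
    · have := h _ (hu (e.symm a).2)
      simp only [rsEnc] at this
      simp only [Pi.sub_apply, sub_mul, Finset.sum_sub_distrib, this, sub_self]
  exact sub_eq_zero.mp h0

open scoped Classical in
/-- Reed-Solomon codes are `(n, k)` error correction codes. -/
def reedSolomon {K : Type*} [Field K] {n : ℕ} (k : ℕ) (x : Fin n → K)
    (hx : Function.Injective x) : ECC K n k where
  enc := rsEnc k x
  dec r :=
    if h : ∃ w : Fin k → K,
        2 * (Finset.univ.filter fun j => r j ≠ none ∧ r j ≠ some (rsEnc k x w j)).card + k
          ≤ (Finset.univ.filter fun j => r j ≠ none).card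
    then h.choose else 0
  dec_correct w r hw := by
    have hex : ∃ w : Fin k → K,
        2 * (Finset.univ.filter fun j => r j ≠ none ∧ r j ≠ some (rsEnc k x w j)).card + k
          ≤ (Finset.univ.filter fun j => r j ≠ none).card := ⟨w, hw⟩
    rw [dif_pos hex]
    have hv := hex.choose_spec
    set v := hex.choose
    set O := Finset.univ.filter fun j => r j ≠ none
    set e1 := Finset.univ.filter fun j => r j ≠ none ∧ r j ≠ some (rsEnc k x w j)
    set e2 := Finset.univ.filter fun j => r j ≠ none ∧ r j ≠ some (rsEnc k x v j)
    have hc := Finset.le_card_sdiff (e1 ∪ e2) O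
    have hu := Finset.card_union_le e1 e2
    refine rsEnc_unique hx (O \ (e1 ∪ e2)) (by omega) fun j hj => ?_
    simp only [O, e1, e2, Finset.mem_sdiff, Finset.mem_union, Finset.mem_filter, Finset.mem_univ,
      true_and, not_or, not_and, not_not] at hj
    have h1 := hj.2.1 hj.1
    have h2 := hj.2.2 hj.1
    rw [h1] at h2
    exact (Option.some.inj h2).symm

/-! ### Messages and local states -/

/-- The two invocations of the unique agreement protocol. -/
inductive Inst
  | one
  | two

/-- The messages of the protocol. In `symbol q (y, z)`, sent from Node `j` to Node `i`, the entries
are the `i`-th and the `j`-th symbol of Node `j`'s codeword. -/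
inductive Msg (A : Type*)
  | symbol (q : Inst) (p : A × A)
  | si1 (q : Inst) (b : Bool)
  | si2 (q : Inst) (b : Bool)
  | newSymbol (y : A)
  | ready (v : Bool)
  | correctSymbol (y : A)

/-- Local variables of one invocation of the unique agreement protocol; `none` is `⊥`. -/
structure BUAState (A : Type*) (n k : ℕ) where
  /-- the input message, `none` as long as there is no input -/
  input : Option (Fin k → A)
  /-- the first `SYMBOL` pair received from each node; it is delivered to the main protocol on
  receipt, while its comparison with the node's own codeword waits for the input -/
  sym : Fin n → Option (A × A)
  /-- the success indicators of the two phases -/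
  s1 : Option Bool
  s2 : Option Bool
  /-- the first success indicators received from each node -/
  rs1 : Fin n → Option Bool
  rs2 : Fin n → Option Bool
  /-- the delivered triple `[message, second success indicator, vote]` -/
  deliv : Option (Option (Fin k → A) × Option Bool × Bool)

/-- Progress of a node in the handler of the multicast phase. -/
inductive Phase
  | off
  | on
  | waitMajority
  | waitDecode

/-- Local state of a node. -/
structure NodeState (A : Type*) (n k : ℕ) where
  /-- the initial message of the node -/
  input : Option (Fin k → A)
  bua1 : BUAState A n k
  bua2 : BUAState A n k
  /-- symbols collected for the first online error correction, and whether it has succeeded -/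
  newSyms : Fin n → Option A
  oecDone : Bool
  /-- the message `M̃` prepared for the second unique agreement -/
  mtil : Option (Fin k → A)
  /-- the majority symbol sent by this node -/
  maj : Option A
  /-- input given to, and output obtained from, the binary agreement -/
  abbaIn : Option Bool
  abbaOut : Option Bool
  /-- the nodes from which `READY v` was received -/
  readyFrom : Bool → Finset (Fin n)
  /-- the output of the binary reliable agreement -/
  vOut : Option Bool
  phase : Phase
  /-- symbols collected for the second online error correction, whether it has succeeded, and the
  decoded message -/
  corrSyms : Fin n → Option A
  finDone : Bool
  decoded : Option (Fin k → A)
  /-- `none` before the output; `some m` when `m` (possibly `⊥`) was output. A node terminates when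
  it outputs. -/
  output : Option (Option (Fin k → A))
  /-- all pairs (addressee, message) sent so far -/
  sent : Set (Fin n × Msg A)

variable {A : Type*} {n k : ℕ}

def BUAState.initial : BUAState A n k where
  input := none
  sym := fun _ => none
  s1 := none
  s2 := none
  rs1 := fun _ => none
  rs2 := fun _ => none
  deliv := none

def NodeState.initial : NodeState A n k where
  input := none
  bua1 := BUAState.initial
  bua2 := BUAState.initial
  newSyms := fun _ => none
  oecDone := false
  mtil := none
  maj := none
  abbaIn := none
  abbaOut := none
  readyFrom := fun _ => ∅
  vOut := none
  phase := Phase.off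
  corrSyms := fun _ => none
  finDone := false
  decoded := none
  output := none
  sent := ∅

/-- The vote. -/
def BUAState.vote (b : BUAState A n k) : Option Bool := b.deliv.map fun d => d.2.2

open scoped Classical in
/-- The link sets of Node `i`: the nodes whose symbol pair matches (`c = true`), respectively does
not match (`c = false`), the codeword of Node `i`; they are empty before Node `i` has encoded. -/
def BUAState.links (C : ECC A n k) (i : Fin n) (b : BUAState A n k) (c : Bool) : Finset (Fin n) :=
  Finset.univ.filter fun j => ∃ w p, b.input = some w ∧ b.sym j = some p ∧
    (c = true ↔ p = (C.enc w i, C.enc w j))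

/-- The nodes that reported the first-phase success indicator `c`. -/
def BUAState.set1 (b : BUAState A n k) (c : Bool) : Finset (Fin n) :=
  Finset.univ.filter fun j => b.rs1 j = some c

/-- The nodes that reported the second-phase success indicator `c`. -/
def BUAState.set2 (b : BUAState A n k) (c : Bool) : Finset (Fin n) :=
  Finset.univ.filter fun j => b.rs2 j = some c

open scoped Classical in
/-- The nodes whose symbol pair has first entry `y`. -/
def BUAState.voters (b : BUAState A n k) (y : A) : Finset (Fin n) :=
  Finset.univ.filter fun j => ∃ z, b.sym j = some (y, z)

def NodeState.bua (s : NodeState A n k) : Inst → BUAState A n k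
  | Inst.one => s.bua1
  | Inst.two => s.bua2

def NodeState.setBua (s : NodeState A n k) (q : Inst) (b : BUAState A n k) : NodeState A n k :=
  match q with
  | Inst.one => { s with bua1 := b }
  | Inst.two => { s with bua2 := b }

/-- Send `m` to all nodes. -/
def NodeState.sendAll (s : NodeState A n k) (m : Msg A) : NodeState A n k :=
  { s with sent := s.sent ∪ {x | x.2 = m} }

/-- Node `i` passes `w` to the unique agreement `q`: it encodes `w` and sends to every Node `j` the
`j`-th and the `i`-th symbol. -/
def NodeState.passInput (C : ECC A n k) (i : Fin n) (q : Inst) (w : Fin k → A)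
    (s : NodeState A n k) : NodeState A n k :=
  let s' := s.setBua q { s.bua q with input := some w }
  { s' with sent := s'.sent ∪ {x | x.2 = Msg.symbol q (C.enc w x.1, C.enc w i)} }

open scoped Classical in
/-- The test of online error correction: at least `k + t` symbols have been collected, and at least
`k + t` of them agree with the codeword of the decoded message. -/
def oecOK (C : ECC A n k) (t : ℕ) (r : Fin n → Option A) : Prop :=
  k + t ≤ (Finset.univ.filter fun j => r j ≠ none).card ∧
  k + t ≤ (Finset.univ.filter fun j => r j = some (C.enc (C.dec r) j)).card

open scoped Classical in
/-- Add the symbol `y` of Node `j` to the first collection and run online error correction. -/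
def NodeState.addNew (C : ECC A n k) (t : ℕ) (j : Fin n) (y : A) (s : NodeState A n k) :
    NodeState A n k :=
  let r := Function.update s.newSyms j (some y)
  if s.oecDone = false ∧ oecOK C t r then
    { s with newSyms := r, mtil := some (C.dec r), oecDone := true }
  else { s with newSyms := r }

open scoped Classical in
/-- Add the symbol `y` of Node `j` to the second collection and run online error correction. -/
def NodeState.addCorr (C : ECC A n k) (t : ℕ) (j : Fin n) (y : A) (s : NodeState A n k) :
    NodeState A n k :=
  let r := Function.update s.corrSyms j (some y)
  if oecOK C t r then
    { s with corrSyms := r, decoded := some (C.dec r), finDone := true }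
  else { s with corrSyms := r }

/-! ### The handlers -/

/-- One handler ("upon ... do ...") whose condition concerns only the local state of Node `i` is
executed: the state `s` becomes `s'`. -/
inductive LocalStep (C : ECC A n k) (t : ℕ) (i : Fin n) :
    NodeState A n k → NodeState A n k → Prop
  -- unique agreement, phase 1
  | s1One (s : NodeState A n k) (q : Inst)
      (h : n - t ≤ ((s.bua q).links C i true).card) (h' : (s.bua q).s1 = none) :
      LocalStep C t i s
        ((s.setBua q { s.bua q with s1 := some true }).sendAll (Msg.si1 q true))
  | s1Zero (s : NodeState A n k) (q : Inst)
      (h : t + 1 ≤ ((s.bua q).links C i false).card) (h' : (s.bua q).s1 = none) :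
      LocalStep C t i s
        ((s.setBua q { s.bua q with s1 := some false }).sendAll (Msg.si1 q false))
  -- unique agreement, phase 2
  | s2Zero (s : NodeState A n k) (q : Inst)
      (h : (s.bua q).s1 = some false ∨
        t + 1 ≤ ((s.bua q).set1 false ∪ (s.bua q).links C i false).card)
      (h' : (s.bua q).s2 = none) :
      LocalStep C t i s
        ((s.setBua q { s.bua q with s2 := some false }).sendAll (Msg.si2 q false))
  | s2One (s : NodeState A n k) (q : Inst) (h : (s.bua q).s1 = some true)
      (h1 : n - t ≤ ((s.bua q).set1 true ∩ (s.bua q).links C i true).card)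
      (h' : (s.bua q).s2 = none) :
      LocalStep C t i s
        ((s.setBua q { s.bua q with s2 := some true }).sendAll (Msg.si2 q true))
  | voteOne (s : NodeState A n k) (q : Inst) (h : n - t ≤ ((s.bua q).set2 true).card)
      (h' : (s.bua q).deliv = none) :
      LocalStep C t i s (s.setBua q
        { s.bua q with deliv := some ((s.bua q).input, (s.bua q).s2, true) })
  | voteZero (s : NodeState A n k) (q : Inst) (h : t + 1 ≤ ((s.bua q).set2 false).card)
      (h' : (s.bua q).deliv = none) :
      LocalStep C t i s (s.setBua q
        { s.bua q with deliv := some ((s.bua q).input, (s.bua q).s2, false) })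
  -- setting the input of the second unique agreement
  | collectNew (s : NodeState A n k) (j : Fin n) (p : A × A) (h : s.bua1.sym j = some p)
      (h1 : j ∈ s.bua1.set1 true) (h' : s.newSyms j = none) :
      LocalStep C t i s (s.addNew C t j p.2)
  | majority (s : NodeState A n k) (y : A)
      (h : n - t ≤ (s.bua1.voters y ∪ s.bua1.set2 false).card)
      (h1 : n - 2 * t ≤ (s.bua1.voters y).card) (h2 : s.bua1.s1 ≠ some true)
      (h' : s.maj = none) :
      LocalStep C t i s ({ s with maj := some y }.sendAll (Msg.newSymbol y))
  | inputTwoOwn (s : NodeState A n k) (w : Fin k → A) (h : s.bua1.s2 = some true)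
      (hw : s.input = some w) (h' : s.bua2.input = none) :
      LocalStep C t i s ({ s with mtil := some w }.passInput C i Inst.two w)
  | inputTwoDecoded (s : NodeState A n k) (w : Fin k → A) (hw : s.mtil = some w)
      (h' : s.bua2.input = none) :
      LocalStep C t i s (s.passInput C i Inst.two w)
  -- inputs of the binary agreement
  | abbaFromTwo (s : NodeState A n k) (m : Option (Fin k → A)) (r : Option Bool) (v : Bool)
      (h : s.bua2.deliv = some (m, r, v)) (h' : s.abbaIn = none) :
      LocalStep C t i s { s with abbaIn := some v }
  | abbaFromOne (s : NodeState A n k) (h : s.bua1.vote = some false ∨ s.bua1.s2 = some false)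
      (h' : s.abbaIn = none) :
      LocalStep C t i s { s with abbaIn := some false }
  -- binary reliable agreement
  | readyRelay (s : NodeState A n k) (v : Bool) (h : t + 1 ≤ (s.readyFrom v).card)
      (h' : ∀ j u, (j, Msg.ready u) ∉ s.sent) :
      LocalStep C t i s (s.sendAll (Msg.ready v))
  | decideZero (s : NodeState A n k) (h : 2 * t + 1 ≤ (s.readyFrom false).card)
      (h' : s.vOut = none) :
      LocalStep C t i s { s with vOut := some false, output := some none }
  | decideOne (s : NodeState A n k) (h : 2 * t + 1 ≤ (s.readyFrom true).card)
      (h' : s.vOut = none) :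
      LocalStep C t i s { s with vOut := some true, phase := Phase.on }
  -- multicast
  | outputDirect (s : NodeState A n k) (m : Option (Fin k → A)) (v : Bool)
      (h : s.phase = Phase.on) (h1 : s.bua2.deliv = some (m, some true, v)) :
      LocalStep C t i s { s with output := some m }
  | enterElse (s : NodeState A n k) (h : s.phase = Phase.on)
      (h1 : ∀ m v, s.bua2.deliv ≠ some (m, some true, v)) :
      LocalStep C t i s { s with phase := Phase.waitMajority }
  | calibrate (s : NodeState A n k) (y : A) (h : s.phase = Phase.waitMajority)
      (h1 : t + 1 ≤ (s.bua2.voters y ∩ s.bua2.set2 true).card) :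
      LocalStep C t i s
        ({ s with phase := Phase.waitDecode }.sendAll (Msg.correctSymbol y))
  | outputDecoded (s : NodeState A n k) (h : s.phase = Phase.waitDecode)
      (h1 : s.finDone = true) :
      LocalStep C t i s { s with output := some s.decoded }
  | collectCorr (s : NodeState A n k) (j : Fin n) (p : A × A) (h : s.bua2.sym j = some p)
      (h1 : j ∈ s.bua2.set2 true) (h' : s.corrSyms j = none) (h2 : s.finDone = false) :
      LocalStep C t i s (s.addCorr C t j p.2)

/-- Effect of the receipt of a message from Node `j`. -/
def NodeState.receive (C : ECC A n k) (t : ℕ) (j : Fin n) (s : NodeState A n k) :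
    Msg A → NodeState A n k
  | Msg.symbol q p =>
    match (s.bua q).sym j with
    | none => s.setBua q { s.bua q with sym := Function.update (s.bua q).sym j (some p) }
    | some _ => s
  | Msg.si1 q c =>
    match (s.bua q).rs1 j with
    | none => s.setBua q { s.bua q with rs1 := Function.update (s.bua q).rs1 j (some c) }
    | some _ => s
  | Msg.si2 q c =>
    match (s.bua q).rs2 j with
    | none => s.setBua q { s.bua q with rs2 := Function.update (s.bua q).rs2 j (some c) }
    | some _ => s
  | Msg.newSymbol y =>
    match s.newSyms j with
    | none => s.addNew C t j y
    | some _ => s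
  | Msg.ready v =>
    { s with readyFrom := Function.update s.readyFrom v (insert j (s.readyFrom v)) }
  | Msg.correctSymbol y =>
    match s.corrSyms j, s.finDone with
    | none, false => s.addCorr C t j y
    | _, _ => s

/-! ### Executions -/

/-- Events of an execution: nothing happens; Node `i` executes a handler; Node `i` receives its
initial message; Node `i` receives a message from Node `j`; the binary agreement outputs at
Node `i`. -/
inductive Event (A : Type*) (n k : ℕ)
  | idle
  | act (i : Fin n)
  | input (i : Fin n) (w : Fin k → A)
  | recv (i j : Fin n) (m : Msg A)
  | abba (i : Fin n) (v : Bool)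

/-- No handler of Node `i` is enabled. -/
def Quiescent (C : ECC A n k) (t : ℕ) (i : Fin n) (s : NodeState A n k) : Prop :=
  ∀ s', ¬ LocalStep C t i s s'

/-- Node `i` is honest and running and has finished its reaction to the previous external event. -/
def Available (C : ECC A n k) (t : ℕ) (F : Finset (Fin n)) (c : Fin n → NodeState A n k)
    (i : Fin n) : Prop :=
  i ∉ F ∧ (c i).output = none ∧ Quiescent C t i (c i)

/-- The event `e` leads from the configuration `c` to the configuration `c'`, where `F` is the set
of dishonest nodes (whose entries in a configuration are irrelevant). Dishonest nodes send anything
at any time; a message from an honest node is received only if that node sent it. -/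
def Step (C : ECC A n k) (t : ℕ) (F : Finset (Fin n)) (c : Fin n → NodeState A n k) :
    Event A n k → (Fin n → NodeState A n k) → Prop
  | Event.idle, c' => c' = c
  | Event.act i, c' => i ∉ F ∧ (c i).output = none ∧
      ∃ s', LocalStep C t i (c i) s' ∧ c' = Function.update c i s'
  | Event.input i w, c' => Available C t F c i ∧ (c i).input = none ∧
      c' = Function.update c i ({ c i with input := some w }.passInput C i Inst.one w)
  | Event.recv i j m, c' => Available C t F c i ∧ (j ∈ F ∨ (i, m) ∈ (c j).sent) ∧
      c' = Function.update c i ((c i).receive C t j m)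
  | Event.abba i v, c' => Available C t F c i ∧ (c i).abbaOut = none ∧
      c' = Function.update c i ({ c i with abbaOut := some v }.sendAll (Msg.ready v))

/-- An execution of the protocol in an asynchronous network: an infinite sequence of
configurations and events. Messages between honest nodes may be delayed arbitrarily but are
eventually received by every addressee that does not terminate, and enabled handlers are
eventually executed. -/
structure Execution (C : ECC A n k) (t : ℕ) (F : Finset (Fin n)) where
  cfg : ℕ → Fin n → NodeState A n k
  ev : ℕ → Event A n k
  start : ∀ i, cfg 0 i = NodeState.initial
  step : ∀ T, Step C t F (cfg T) (ev T) (cfg (T + 1))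
  delivery : ∀ T i j m, i ∉ F → j ∉ F → (i, m) ∈ (cfg T j).sent →
    (∃ T', ev T' = Event.recv i j m) ∨ ∃ T', (cfg T' i).output ≠ none
  progress : ∀ T i, i ∉ F → (cfg T i).output = none → ¬ Quiescent C t i (cfg T i) →
    ∃ T', T ≤ T' ∧ ev T' = Event.act i

/-- The guarantees of the invoked asynchronous binary agreement, at the honest nodes. -/
structure ABBACorrect {C : ECC A n k} {t : ℕ} {F : Finset (Fin n)} (E : Execution C t F) :
    Prop where
  /-- If every honest node gives an input and none of them stops participating, then every honest
  node obtains an output. -/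
  termination : (∀ i, i ∉ F → ∃ T, (E.cfg T i).abbaIn ≠ none) →
    (∀ i, i ∉ F → ∀ T, (E.cfg T i).output = none) →
    ∀ i, i ∉ F → ∃ T, (E.cfg T i).abbaOut ≠ none
  /-- All outputs agree. -/
  consistency : ∀ i j, i ∉ F → j ∉ F → ∀ T T' u v,
    (E.cfg T i).abbaOut = some u → (E.cfg T' j).abbaOut = some v → u = v
  /-- If no honest node gives an input different from `v`, then only `v` is output. -/
  validity : ∀ v, (∀ i, i ∉ F → ∀ T, (E.cfg T i).abbaIn ≠ some (!v)) →
    ∀ i, i ∉ F → ∀ T u, (E.cfg T i).abbaOut = some u → u = v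

end ACOOL

end

/-! The argument splits into safety and liveness.

Safety. If all honest nodes start with `w`, every symbol sent by an honest node is the correct
symbol of `w`. A rule that sets an indicator or a vote to 0 needs either an earlier local 0 or `t +
1` witnesses, all of which would lie in `F`; so no such rule ever fires. Online error correction can
return nothing but `w`: an accepted decoding agrees with `k + t` collected symbols, at least `k` of
them honest, and `k` symbols determine a message. These facts form the invariant `Safe`. It rests on
`Book`, which relates the local variables of a node to the messages it has sent and needs no
assumption on the inputs.

Liveness. No schedule is analysed. Every handler fills one of finitely many set-once slots, so an
honest node that never outputs is eventually quiescent (`Execution.eventually_quiescent`), and it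
eventually receives every message that honest nodes address to it (`Execution.eventually_received`).
At a late time both hold, and a missing local action would then be an enabled handler, a
contradiction.

The difficulty is that a node falls silent when it outputs, so liveness of the unique agreements and
of ABBA is available only while no honest node has output. Hence the case distinction in
`Unanimous.exists_output`. If no honest node ever outputs, both unique agreements succeed, ABBA
outputs 1 everywhere, and all honest nodes send `READY 1`. If some honest node outputs, its `2 * t +
1` received `READY 1` include `t + 1` honest ones, which make every honest node send `READY 1`. In
both cases `READY 1` goes back to an honest vote 1 in the second agreement, hence to `n - 2 * t ≥ t
+ 1` honest nodes with second indicator 1. Their symbols let every running node find its own symbol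
of `w`. So each honest node, whether or not it has terminated, contributes its symbol to the final
decoding. -/

noncomputable section

namespace ACOOL

variable {A : Type*} {n k : ℕ} {C : ECC A n k} {t : ℕ} {F : Finset (Fin n)}

/-! ### Online error correction -/

/-- The decoder fed with exactly the common symbols on `S` sees no error for either message, so it
must return both. -/
theorem ECC.enc_unique (C : ECC A n k) {u w : Fin k → A} (S : Finset (Fin n)) (hS : k ≤ S.card)
    (h : ∀ j ∈ S, C.enc u j = C.enc w j) : u = w := by
  classical
  have key : ∀ v : Fin k → A, (∀ j ∈ S, C.enc u j = C.enc v j) →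
      C.dec (fun j => if j ∈ S then some (C.enc u j) else none) = v := by
    intro v hv
    apply C.dec_correct
    have h1 : (Finset.univ.filter fun j => (if j ∈ S then some (C.enc u j) else none) ≠ none ∧
        (if j ∈ S then some (C.enc u j) else none) ≠ some (C.enc v j)) = ∅ := by
      ext j
      by_cases hj : j ∈ S <;> simp_all
    have h2 : (Finset.univ.filter fun j =>
        (if j ∈ S then some (C.enc u j) else none) ≠ none) = S := by
      ext j
      by_cases hj : j ∈ S <;> simp_all
    simp only [h1, h2]
    simpa using hS
  rw [← key u fun _ _ => rfl, key w h]

/-- Of the `k + t` symbols agreeing with the decoded codeword at most `t` come from `F`; the other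
`k` or more agree with the codeword of `w` as well. -/
theorem oecOK_sound {C : ECC A n k} {t : ℕ} {F : Finset (Fin n)} {w : Fin k → A}
    (hF : F.card ≤ t) {r : Fin n → Option A}
    (hr : ∀ j, j ∉ F → ∀ y, r j = some y → y = C.enc w j) (h : oecOK C t r) :
    C.dec r = w := by
  classical
  have h2 := h.2
  refine C.enc_unique ((Finset.univ.filter fun j => r j = some (C.enc (C.dec r) j)) \ F) ?_ ?_
  · have := Finset.le_card_sdiff F (Finset.univ.filter fun j => r j = some (C.enc (C.dec r) j))
    omega
  · intro j hj
    simp only [Finset.mem_sdiff, Finset.mem_filter, Finset.mem_univ, true_and] at hj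
    exact hr j hj.2 _ hj.1

/-- With `e ≤ t` wrong symbols, all from `F`, there are at least `n - F.card + e` observed ones, so
`2 * e + k` is within the decoding radius. The honest symbols alone then pass the test. -/
theorem oecOK_complete {C : ECC A n k} {t : ℕ} {F : Finset (Fin n)} {w : Fin k → A}
    (hF : F.card ≤ t) (hn : k + 2 * t ≤ n) {r : Fin n → Option A}
    (hr : ∀ j, j ∉ F → r j = some (C.enc w j)) : oecOK C t r := by
  classical
  set e := Finset.univ.filter fun j => r j ≠ none ∧ r j ≠ some (C.enc w j) with he
  have heF : e ⊆ F := by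
    intro j hj
    by_contra hjF
    simp [he, hr j hjF] at hj
  have hc : Fᶜ.card = n - F.card := by rw [Finset.card_compl, Fintype.card_fin]
  have h1 : Fᶜ ∪ e ⊆ Finset.univ.filter fun j => r j ≠ none := by
    intro j hj
    rcases Finset.mem_union.mp hj with hj | hj
    · simp [hr j (by simpa using hj)]
    · simp only [he, Finset.mem_filter, Finset.mem_univ, true_and] at hj ⊢
      exact hj.1
  have hd : Disjoint Fᶜ e := Finset.disjoint_left.mpr fun j hj hj' =>
    (Finset.mem_compl.mp hj) (heF hj')
  have h2 := Finset.card_le_card h1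
  rw [Finset.card_union_of_disjoint hd] at h2
  have h3 := Finset.card_le_card heF
  have hdec : C.dec r = w := by
    apply C.dec_correct
    change 2 * e.card + k ≤ _
    omega
  refine ⟨by omega, ?_⟩
  have h4 : Fᶜ ⊆ Finset.univ.filter fun j => r j = some (C.enc (C.dec r) j) := by
    intro j hj
    simpa [hdec] using hr j (by simpa using hj)
  have := Finset.card_le_card h4
  omega

theorem exists_honest {t : ℕ} {F S : Finset (Fin n)} (hF : F.card ≤ t) (hS : t + 1 ≤ S.card) :
    ∃ j ∈ S, j ∉ F := by
  by_contra! h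
  have := Finset.card_le_card (show S ⊆ F from h)
  omega

theorem le_card_of_honest {t : ℕ} {F S : Finset (Fin n)} (hF : F.card ≤ t)
    (hS : ∀ j, j ∉ F → j ∈ S) : n - t ≤ S.card := by
  have h : Fᶜ ⊆ S := fun j hj => hS j (by simpa using hj)
  have := Finset.card_le_card h
  rw [Finset.card_compl, Fintype.card_fin] at this
  omega

/-- A normal form in which the outcome of the test is hidden in `m` and `d`, so that every other
field can be read off without a case distinction. -/
theorem NodeState.addNew_eq (C : ECC A n k) (t : ℕ) (j : Fin n) (y : A) (s : NodeState A n k) :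
    ∃ m d, s.addNew C t j y =
        { s with newSyms := Function.update s.newSyms j (some y), mtil := m, oecDone := d } ∧
      (m = s.mtil ∨ oecOK C t (Function.update s.newSyms j (some y)) ∧
        m = some (C.dec (Function.update s.newSyms j (some y)))) := by
  unfold NodeState.addNew
  dsimp only
  split
  · rename_i h
    exact ⟨_, _, rfl, Or.inr ⟨h.2, rfl⟩⟩
  · exact ⟨_, _, rfl, Or.inl rfl⟩

theorem NodeState.addCorr_eq (C : ECC A n k) (t : ℕ) (j : Fin n) (y : A) (s : NodeState A n k) :
    ∃ d f, s.addCorr C t j y =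
        { s with corrSyms := Function.update s.corrSyms j (some y), decoded := d, finDone := f } ∧
      (f = s.finDone ∧ d = s.decoded ∧ ¬ oecOK C t (Function.update s.corrSyms j (some y)) ∨
        f = true ∧ oecOK C t (Function.update s.corrSyms j (some y)) ∧
          d = some (C.dec (Function.update s.corrSyms j (some y)))) := by
  unfold NodeState.addCorr
  dsimp only
  split
  · rename_i h
    exact ⟨_, _, rfl, Or.inr ⟨rfl, h, rfl⟩⟩
  · rename_i h
    exact ⟨_, _, rfl, Or.inl ⟨rfl, rfl, h⟩⟩

/-! ### Transitions of a single node -/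

/-- A transition of Node `i`; `I`, `R` and `O` restrict the possible initial messages, received
messages and outputs of the binary agreement. -/
inductive NodeStep (C : ECC A n k) (t : ℕ) (i : Fin n) (I : (Fin k → A) → Prop)
    (R : Fin n → Msg A → Prop) (O : Bool → Prop) : NodeState A n k → NodeState A n k → Prop
  | act (s s' : NodeState A n k) (h : LocalStep C t i s s') (ho : s.output = none) :
      NodeStep C t i I R O s s'
  | input (s : NodeState A n k) (w : Fin k → A) (h : s.input = none) (hI : I w) :
      NodeStep C t i I R O s ({ s with input := some w }.passInput C i Inst.one w)
  | symbol (s : NodeState A n k) (j : Fin n) (q : Inst) (p : A × A)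
      (hR : R j (Msg.symbol q p)) (h : (s.bua q).sym j = none) :
      NodeStep C t i I R O s
        (s.setBua q { s.bua q with sym := Function.update (s.bua q).sym j (some p) })
  | si1 (s : NodeState A n k) (j : Fin n) (q : Inst) (c : Bool)
      (hR : R j (Msg.si1 q c)) (h : (s.bua q).rs1 j = none) :
      NodeStep C t i I R O s
        (s.setBua q { s.bua q with rs1 := Function.update (s.bua q).rs1 j (some c) })
  | si2 (s : NodeState A n k) (j : Fin n) (q : Inst) (c : Bool)
      (hR : R j (Msg.si2 q c)) (h : (s.bua q).rs2 j = none) :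
      NodeStep C t i I R O s
        (s.setBua q { s.bua q with rs2 := Function.update (s.bua q).rs2 j (some c) })
  | newSymbol (s : NodeState A n k) (j : Fin n) (y : A)
      (hR : R j (Msg.newSymbol y)) (h : s.newSyms j = none) :
      NodeStep C t i I R O s (s.addNew C t j y)
  | ready (s : NodeState A n k) (j : Fin n) (v : Bool) (hR : R j (Msg.ready v))
      (hq : Quiescent C t i s) :
      NodeStep C t i I R O s
        { s with readyFrom := Function.update s.readyFrom v (insert j (s.readyFrom v)) }
  | correctSymbol (s : NodeState A n k) (j : Fin n) (y : A)
      (hR : R j (Msg.correctSymbol y)) (h : s.corrSyms j = none) (h2 : s.finDone = false) :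
      NodeStep C t i I R O s (s.addCorr C t j y)
  | abba (s : NodeState A n k) (v : Bool) (h : s.abbaOut = none) (hO : O v) :
      NodeStep C t i I R O s ({ s with abbaOut := some v }.sendAll (Msg.ready v))

theorem NodeStep.of_receive {C : ECC A n k} {t : ℕ} {i : Fin n} {I : (Fin k → A) → Prop}
    {R : Fin n → Msg A → Prop} {O : Bool → Prop} {s : NodeState A n k} {j : Fin n} {m : Msg A}
    (hq : Quiescent C t i s) (hR : R j m) :
    s.receive C t j m = s ∨ NodeStep C t i I R O s (s.receive C t j m) := by
  cases m <;> unfold NodeState.receive <;> dsimp only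
  · split
    · exact Or.inr (.symbol _ _ _ _ hR ‹_›)
    · exact Or.inl rfl
  · split
    · exact Or.inr (.si1 _ _ _ _ hR ‹_›)
    · exact Or.inl rfl
  · split
    · exact Or.inr (.si2 _ _ _ _ hR ‹_›)
    · exact Or.inl rfl
  · split
    · exact Or.inr (.newSymbol _ _ _ hR ‹_›)
    · exact Or.inl rfl
  · exact Or.inr (.ready _ _ _ hR hq)
  · split
    · exact Or.inr (.correctSymbol _ _ _ hR ‹_› ‹_›)
    · exact Or.inl rfl

/-- The bridge from global to local reasoning. The condition on received messages is authentication.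
Inputs and ABBA outputs are read off the successor configuration, so that hypotheses about all times
apply to them directly. The first alternative covers idle steps, steps of other nodes and ignored
messages. -/
theorem Execution.nodeStep (E : Execution C t F) (T : ℕ) (i : Fin n) :
    E.cfg (T + 1) i = E.cfg T i ∨
      NodeStep C t i (fun w => (E.cfg (T + 1) i).input = some w)
        (fun j m => j ∉ F → (i, m) ∈ (E.cfg T j).sent)
        (fun v => (E.cfg (T + 1) i).abbaOut = some v) (E.cfg T i) (E.cfg (T + 1) i) := by
  have h := E.step T
  rcases he : E.ev T with _ | i' | ⟨i', w⟩ | ⟨i', j, m⟩ | ⟨i', v⟩ <;> rw [he] at h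
  · left
    rw [show E.cfg (T + 1) = E.cfg T from h]
  all_goals
    by_cases hii : i = i'
    swap
    · left
      first
      | obtain ⟨_, _, h⟩ := h
        try obtain ⟨_, _, h⟩ := h
        rw [h, Function.update_of_ne hii]
    subst hii
  · obtain ⟨_, ho, s', hs, h⟩ := h
    rw [h, Function.update_self]
    exact Or.inr (.act _ _ hs ho)
  · obtain ⟨_, hn, h⟩ := h
    rw [h, Function.update_self]
    exact Or.inr (.input _ _ hn rfl)
  · obtain ⟨ha, hm, h⟩ := h
    rw [h, Function.update_self]
    exact NodeStep.of_receive ha.2.2 fun hj => hm.resolve_left hj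
  · obtain ⟨_, hn, h⟩ := h
    rw [h, Function.update_self]
    exact Or.inr (.abba _ _ hn rfl)

/-- Assuming `P` for all honest nodes at the same time lets facts about a sender pass to the
receiver. The new state is a variable so that the transition can be analysed by cases. -/
theorem Execution.invariant (E : Execution C t F) {P : Fin n → NodeState A n k → Prop}
    (h0 : ∀ i, P i NodeState.initial)
    (hs : ∀ T i s', i ∉ F → (∀ j, j ∉ F → P j (E.cfg T j)) →
      NodeStep C t i (fun w => (E.cfg (T + 1) i).input = some w)
        (fun j m => j ∉ F → (i, m) ∈ (E.cfg T j).sent)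
        (fun v => (E.cfg (T + 1) i).abbaOut = some v) (E.cfg T i) s' → P i s')
    (T : ℕ) (i : Fin n) (hi : i ∉ F) : P i (E.cfg T i) := by
  induction T generalizing i with
  | zero => rw [E.start]; exact h0 i
  | succ T ih =>
    rcases E.nodeStep T i with h | h
    · rw [h]; exact ih i hi
    · exact hs T i _ hi ih h

@[simp] theorem NodeState.initial_bua (q : Inst) :
    (NodeState.initial : NodeState A n k).bua q = BUAState.initial := by
  cases q <;> rfl

theorem NodeState.forall_setBua {P : Inst → BUAState A n k → Prop} {s : NodeState A n k}
    {q : Inst} {b : BUAState A n k} (h : ∀ q', P q' (s.bua q')) (hb : P q b) (q' : Inst) :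
    P q' ((s.setBua q b).bua q') := by
  cases q <;> cases q' <;> first | exact hb | exact h _

/-! ### Local bookkeeping invariants -/

/-- Relations between the variables of one unique agreement and the messages sent. -/
structure BUABook (C : ECC A n k) (t : ℕ) (i : Fin n) (q : Inst) (b : BUAState A n k)
    (sent : Set (Fin n × Msg A)) : Prop where
  input : ∀ u, b.input = some u → ∀ j, (j, Msg.symbol q (C.enc u j, C.enc u i)) ∈ sent
  s1 : ∀ c, b.s1 = some c → ∀ j, (j, Msg.si1 q c) ∈ sent
  s2 : ∀ c, b.s2 = some c → ∀ j, (j, Msg.si2 q c) ∈ sent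
  s2_of_sent : ∀ j c, (j, Msg.si2 q c) ∈ sent → b.s2 = some c
  input_of_s1 : b.s1 = some true → b.input ≠ none
  s1_of_s2 : b.s2 = some true → b.s1 = some true
  deliv_set2 : ∀ m r, b.deliv = some (m, r, true) → n - t ≤ (b.set2 true).card
  deliv_s2 : ∀ m v, b.deliv = some (m, some true, v) → b.s2 = some true

/-- Relations between the local variables of a node and the messages sent. -/
structure Book (C : ECC A n k) (t : ℕ) (i : Fin n) (s : NodeState A n k) : Prop where
  bua : ∀ q, BUABook C t i q (s.bua q) s.sent
  input : s.bua1.input = s.input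
  abbaIn : s.abbaIn = some true → ∃ m r, s.bua2.deliv = some (m, r, true)
  abbaOut : ∀ v, s.abbaOut = some v → ∀ j, (j, Msg.ready v) ∈ s.sent
  ready : ∀ j v, (j, Msg.ready v) ∈ s.sent → ∀ j', (j', Msg.ready v) ∈ s.sent
  relay : ∀ v, t + 2 ≤ (s.readyFrom v).card → ∃ j u, (j, Msg.ready u) ∈ s.sent
  vOut : ∀ v, s.vOut = some v → 2 * t + 1 ≤ (s.readyFrom v).card
  vOut_of_phase : s.phase ≠ Phase.off → s.vOut = some true
  phase : s.vOut = some true → s.phase ≠ Phase.off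
  waitDecode : s.phase = Phase.waitDecode → ∃ y, ∀ j, (j, Msg.correctSymbol y) ∈ s.sent
  vOut_of_output : s.output ≠ none → s.vOut ≠ none
  output : s.output ≠ none → s.vOut = some true →
    s.bua2.s2 = some true ∨ s.phase = Phase.waitDecode
  finDone : s.finDone = false → ¬ oecOK C t s.corrSyms

theorem BUABook.mono {i : Fin n} {q : Inst} {b : BUAState A n k} {X Y : Set (Fin n × Msg A)}
    (h : BUABook C t i q b X) (hXY : X ⊆ Y) (hY : ∀ j c, (j, Msg.si2 q c) ∈ Y → (j, Msg.si2 q c) ∈ X) :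
    BUABook C t i q b Y where
  input u hu j := hXY (h.input u hu j)
  s1 c hc j := hXY (h.s1 c hc j)
  s2 c hc j := hXY (h.s2 c hc j)
  s2_of_sent j c hc := h.s2_of_sent j c (hY j c hc)
  input_of_s1 := h.input_of_s1
  s1_of_s2 := h.s1_of_s2
  deliv_set2 := h.deliv_set2
  deliv_s2 := h.deliv_s2

theorem Book.initial (hk : 1 ≤ k) (i : Fin n) :
    Book C t i (NodeState.initial : NodeState A n k) := by
  constructor <;> try simp [NodeState.initial, BUAState.initial, oecOK]
  · intro q
    constructor <;> cases q <;> simp [NodeState.bua]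
  -- What remains is that the empty collection fails the test, because the threshold `k + t` is
  -- positive.
  · omega


theorem NodeState.forall_setBua_sent {P : Inst → BUAState A n k → Prop} {s : NodeState A n k}
    {q : Inst} {b : BUAState A n k} {X : Set (Fin n × Msg A)}
    (h : ∀ q', q' ≠ q → P q' (s.bua q')) (hb : P q b) (q' : Inst) :
    P q' (({ s.setBua q b with sent := X } : NodeState A n k).bua q') := by
  cases q <;> cases q' <;> first | exact hb | exact h _ (by simp)

/-- Outside the clause on unique agreements, `Book` looks at their states only through the input of
the first one, the delivered triple and the second indicator. The last three hypotheses protect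
exactly these. -/
theorem Book.setBua {i : Fin n} {s : NodeState A n k} (hs : Book C t i s) (q : Inst)
    (b : BUAState A n k) (X : Set (Fin n × Msg A)) (hX : s.sent ⊆ X)
    (hready : ∀ j v, (j, Msg.ready v) ∈ X → (j, Msg.ready v) ∈ s.sent)
    (hsi2 : ∀ q', q' ≠ q → ∀ j c, (j, Msg.si2 q' c) ∈ X → (j, Msg.si2 q' c) ∈ s.sent)
    (hb : BUABook C t i q b X) (hin : q = Inst.one → b.input = (s.bua q).input)
    (hd : (s.bua q).deliv ≠ none → b.deliv = (s.bua q).deliv)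
    (hs2 : (s.bua q).s2 ≠ none → b.s2 = (s.bua q).s2) :
    Book C t i { s.setBua q b with sent := X } := by
  refine ⟨NodeState.forall_setBua_sent (P := fun q b => BUABook C t i q b X)
    (fun q' hq => (hs.bua q').mono hX (hsi2 q' hq)) hb, ?_, ?_, ?_, ?_, ?_, ?_, ?_, ?_, ?_, ?_, ?_, ?_⟩
  · cases q
    · exact (hin rfl).trans hs.input
    · exact hs.input
  · intro h
    cases q
    · exact hs.abbaIn h
    · obtain ⟨m, r, h⟩ := hs.abbaIn h
      exact ⟨m, r, (hd (by simp [NodeState.bua, h])).trans h⟩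
  · intro v hv j
    refine hX (hs.abbaOut v ?_ j)
    cases q <;> exact hv
  · exact fun j v h j' => hX (hs.ready j v (hready j v h) j')
  · intro v hv
    obtain ⟨j, u, h⟩ := hs.relay v (by cases q <;> exact hv)
    exact ⟨j, u, hX h⟩
  · cases q <;> exact hs.vOut
  · cases q <;> exact hs.vOut_of_phase
  · cases q <;> exact hs.phase
  · intro h
    obtain ⟨y, hy⟩ := hs.waitDecode (by cases q <;> exact h)
    exact ⟨y, fun j => hX (hy j)⟩
  · cases q <;> exact hs.vOut_of_output
  · intro h h'
    cases q
    · exact hs.output h h'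
    · refine (hs.output h h').imp_left fun h2 => ?_
      exact (hs2 (by simp [NodeState.bua, h2])).trans h2
  · cases q <;> exact hs.finDone

theorem Book.setBua_sent {i : Fin n} {s : NodeState A n k} (hs : Book C t i s) (q : Inst)
    (b : BUAState A n k) (hb : BUABook C t i q b s.sent)
    (hin : q = Inst.one → b.input = (s.bua q).input)
    (hd : (s.bua q).deliv ≠ none → b.deliv = (s.bua q).deliv)
    (hs2 : (s.bua q).s2 ≠ none → b.s2 = (s.bua q).s2) :
    Book C t i (s.setBua q b) := by
  have := hs.setBua q b s.sent subset_rfl (fun _ _ h => h) (fun _ _ _ _ h => h) hb hin hd hs2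
  cases q <;> exact this

theorem Book.setBua_sendAll {i : Fin n} {s : NodeState A n k} (hs : Book C t i s) (q : Inst)
    (b : BUAState A n k) (m : Msg A) (hm : ∀ v, m ≠ Msg.ready v)
    (hm' : ∀ q', q' ≠ q → ∀ c, m ≠ Msg.si2 q' c)
    (hb : BUABook C t i q b (s.sent ∪ {x | x.2 = m}))
    (hin : b.input = (s.bua q).input)
    (hd : b.deliv = (s.bua q).deliv)
    (hs2 : (s.bua q).s2 ≠ none → b.s2 = (s.bua q).s2) :
    Book C t i ((s.setBua q b).sendAll m) := by
  have := hs.setBua q b (s.sent ∪ {x | x.2 = m}) Set.subset_union_left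
    (fun _ _ h => h.resolve_right fun h => hm _ h.symm)
    (fun _ hq _ _ h => h.resolve_right fun h => hm' _ hq _ h.symm) hb (fun _ => hin)
    (fun _ => hd) hs2
  cases q <;> exact this

/-- Sending a message that is neither an indicator nor `READY` preserves the bookkeeping. -/
theorem Book.sent_mono {i : Fin n} {s : NodeState A n k} (hs : Book C t i s)
    (X : Set (Fin n × Msg A)) (hX : s.sent ⊆ X)
    (hready : ∀ j v, (j, Msg.ready v) ∈ X → ∀ j', (j', Msg.ready v) ∈ X)
    (hsi2 : ∀ j q c, (j, Msg.si2 q c) ∈ X → (j, Msg.si2 q c) ∈ s.sent) :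
    Book C t i { s with sent := X } := by
  obtain ⟨hb, h1, h2, h3, h4, h5, h6, h7, h8, h9, h10, h11, h12⟩ := hs
  refine ⟨fun q => ?_, h1, h2, fun v hv j => hX (h3 v hv j), hready,
    fun v hv => (h5 v hv).imp fun j => Exists.imp fun u h => hX h, h6, h7, h8,
    fun h => (h9 h).imp fun y hy j => hX (hy j), h10, h11, h12⟩
  have := (hb q).mono hX fun j c => hsi2 j q c
  cases q <;> exact this

theorem Book.sendAll {i : Fin n} {s : NodeState A n k} (hs : Book C t i s) (m : Msg A)
    (hsi2 : ∀ q c, m ≠ Msg.si2 q c) : Book C t i (s.sendAll m) := by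
  refine hs.sent_mono _ Set.subset_union_left (fun j v h j' => ?_)
    (fun j q c h => h.resolve_right fun h => hsi2 _ _ h.symm)
  exact h.imp (fun h => hs.ready j v h j') fun h => h

theorem Book.passInput {i : Fin n} {s : NodeState A n k} (hs : Book C t i s) (w : Fin k → A) :
    Book C t i (s.passInput C i Inst.two w) := by
  refine hs.setBua Inst.two { s.bua2 with input := some w } _ Set.subset_union_left
    (fun _ _ h => h.resolve_right fun h => by simp at h)
    (fun _ _ _ _ h => h.resolve_right fun h => by simp at h) ?_ (by simp) (fun _ => rfl) (fun _ => rfl)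
  obtain ⟨a1, a2, a3, a4, a5, a6, a7, a8⟩ := hs.bua Inst.two
  refine ⟨?_, fun c h j => Or.inl (a2 c h j), fun c h j => Or.inl (a3 c h j), ?_, by simp, a6, a7, a8⟩
  · rintro u hu j
    cases hu
    exact Or.inr rfl
  · intro j c h
    exact a4 j c (h.resolve_right fun h => by simp at h)

theorem Book.addNew {i : Fin n} {s : NodeState A n k} (hs : Book C t i s) (j : Fin n) (y : A) :
    Book C t i (s.addNew C t j y) := by
  obtain ⟨m, d, h, -⟩ := s.addNew_eq C t j y
  rw [h]
  exact ⟨fun q => by have := hs.bua q; cases q <;> exact this, hs.2, hs.3, hs.4, hs.5, hs.6, hs.7,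
    hs.8, hs.9, hs.10, hs.11, hs.12, hs.13⟩

theorem Book.addCorr {i : Fin n} {s : NodeState A n k} (hs : Book C t i s) (j : Fin n) (y : A) :
    Book C t i (s.addCorr C t j y) := by
  obtain ⟨d, f, h, hf⟩ := s.addCorr_eq C t j y
  rw [h]
  refine ⟨fun q => by have := hs.bua q; cases q <;> exact this, hs.2, hs.3, hs.4, hs.5, hs.6, hs.7,
    hs.8, hs.9, hs.10, hs.11, hs.12, fun hff => ?_⟩
  rcases hf with hf | hf
  · exact hf.2.2
  · exact absurd (hf.1.symm.trans hff) (by simp)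

/-- The delicate clause is `Book.output`. Direct output has second indicator 1 by its triple,
decoded output happens in the last phase, and `decideZero` makes the clause vacuous. Handlers that
change the phase are covered because the node is still running. -/
theorem Book.localStep (ht : 1 ≤ t) (hn : 3 * t + 1 ≤ n) {i : Fin n} {s s' : NodeState A n k}
    (hs : Book C t i s) (h : LocalStep C t i s s') (ho : s.output = none) : Book C t i s' := by
  have links_input : ∀ q c, 1 ≤ ((s.bua q).links C i c).card → (s.bua q).input ≠ none := by
    intro q c hc
    obtain ⟨j, hj⟩ := Finset.card_pos.mp hc
    simp only [BUAState.links, Finset.mem_filter] at hj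
    obtain ⟨-, w, p, hw, -⟩ := hj
    simp [hw]
  cases h with
  | s1One q h h' =>
    refine hs.setBua_sendAll _ _ _ (by simp) (by simp) ?_ rfl rfl (fun _ => rfl)
    obtain ⟨a1, a2, a3, a4, a5, a6, a7, a8⟩ := hs.bua q
    refine ⟨fun u h j => Or.inl (a1 u h j), ?_, fun c h j => Or.inl (a3 c h j),
      fun j c h => a4 j c (h.resolve_right fun h => by simp at h), fun _ => links_input q true (by omega),
      fun _ => rfl, a7, a8⟩
    rintro c hc j
    cases hc
    exact Or.inr rfl
  | s1Zero q h h' =>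
    refine hs.setBua_sendAll _ _ _ (by simp) (by simp) ?_ rfl rfl (fun _ => rfl)
    obtain ⟨a1, a2, a3, a4, a5, a6, a7, a8⟩ := hs.bua q
    refine ⟨fun u h j => Or.inl (a1 u h j), ?_, fun c h j => Or.inl (a3 c h j),
      fun j c h => a4 j c (h.resolve_right fun h => by simp at h), by simp,
      fun h => absurd (h'.symm.trans (a6 h)) (by simp), a7, a8⟩
    rintro c hc j
    cases hc
    exact Or.inr rfl
  | s2Zero q h h' =>
    refine hs.setBua_sendAll _ _ _ (by simp) (fun q' hq c hc => hq (by simp_all)) ?_ rfl rfl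
      (absurd h')
    obtain ⟨a1, a2, a3, a4, a5, a6, a7, a8⟩ := hs.bua q
    refine ⟨fun u h j => Or.inl (a1 u h j), fun c h j => Or.inl (a2 c h j), ?_, ?_, a5, by simp, a7,
      fun m v h => absurd (h'.symm.trans (a8 m v h)) (by simp)⟩
    · rintro c hc j
      cases hc
      exact Or.inr rfl
    · rintro j c (hc | hc)
      · exact absurd (h'.symm.trans (a4 j c hc)) (by simp)
      · cases hc
        rfl
  | s2One q h h1 h' =>
    refine hs.setBua_sendAll _ _ _ (by simp) (fun q' hq c hc => hq (by simp_all)) ?_ rfl rfl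
      (absurd h')
    obtain ⟨a1, a2, a3, a4, a5, a6, a7, a8⟩ := hs.bua q
    refine ⟨fun u h j => Or.inl (a1 u h j), fun c h j => Or.inl (a2 c h j), ?_, ?_, a5,
      fun _ => h, a7, fun _ _ _ => rfl⟩
    · rintro c hc j
      cases hc
      exact Or.inr rfl
    · rintro j c (hc | hc)
      · exact absurd (h'.symm.trans (a4 j c hc)) (by simp)
      · cases hc
        rfl
  | voteOne q h h' =>
    obtain ⟨a1, a2, a3, a4, a5, a6, a7, a8⟩ := hs.bua q
    refine hs.setBua_sent _ _ ⟨a1, a2, a3, a4, a5, a6, fun _ _ _ => h, ?_⟩ (fun _ => rfl) (absurd h')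
      (fun _ => rfl)
    intro m v hm
    simp only [Option.some.injEq, Prod.mk.injEq] at hm
    exact hm.2.1
  | voteZero q h h' =>
    obtain ⟨a1, a2, a3, a4, a5, a6, a7, a8⟩ := hs.bua q
    refine hs.setBua_sent _ _ ⟨a1, a2, a3, a4, a5, a6, by simp, ?_⟩ (fun _ => rfl) (absurd h')
      (fun _ => rfl)
    intro m v hm
    simp only [Option.some.injEq, Prod.mk.injEq] at hm
    exact hm.2.1
  | collectNew j p h h1 h' => exact hs.addNew j p.2
  | majority y h h1 h2 h' =>
    have := hs.sendAll (Msg.newSymbol y) (by simp)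
    exact ⟨fun q => by have := this.bua q; cases q <;> exact this, this.2, this.3, this.4, this.5,
      this.6, this.7, this.8, this.9, this.10, this.11, this.12, this.13⟩
  | inputTwoOwn w h hw h' =>
    have : Book C t i { s with mtil := some w } :=
      ⟨fun q => by have := hs.bua q; cases q <;> exact this, hs.2, hs.3, hs.4, hs.5, hs.6, hs.7,
        hs.8, hs.9, hs.10, hs.11, hs.12, hs.13⟩
    exact this.passInput w
  | inputTwoDecoded w hw h' => exact hs.passInput w
  | abbaFromTwo m r v h h' =>
    refine ⟨fun q => by have := hs.bua q; cases q <;> exact this, hs.2, fun hv => ?_, hs.4, hs.5, hs.6,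
        hs.7, hs.8, hs.9, hs.10, hs.11, hs.12, hs.13⟩
    cases hv
    exact ⟨m, r, h⟩
  | abbaFromOne h h' =>
    refine ⟨fun q => by have := hs.bua q; cases q <;> exact this, hs.2, by simp, hs.4, hs.5, hs.6,
        hs.7, hs.8, hs.9, hs.10, hs.11, hs.12, hs.13⟩
  | readyRelay v h h' => exact hs.sendAll (Msg.ready v) (by simp)
  | decideZero h h' =>
    refine ⟨fun q => by have := hs.bua q; cases q <;> exact this, hs.2, hs.3, hs.4, hs.5, hs.6,
      ?_, fun hp => absurd (h'.symm.trans (hs.8 hp)) (by simp), by simp, hs.10, by simp, by simp,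
      hs.13⟩
    rintro v hv
    cases hv
    exact h
  | decideOne h h' =>
    refine ⟨fun q => by have := hs.bua q; cases q <;> exact this, hs.2, hs.3, hs.4, hs.5, hs.6,
      ?_, fun _ => rfl, by simp, by simp, by simp, fun ho' => absurd ho ho', hs.13⟩
    rintro v hv
    cases hv
    exact h
  | outputDirect m v h h1 =>
    have h2 := hs.vOut_of_phase
    have h3 := (hs.bua Inst.two).deliv_s2
    refine ⟨fun q => by have := hs.bua q; cases q <;> exact this, hs.2, hs.3, hs.4, hs.5, hs.6,
        hs.7, hs.8, hs.9, hs.10, by simp [h2, h], fun _ _ => Or.inl (h3 m v h1), hs.13⟩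
  | enterElse h h1 =>
    have h2 := hs.vOut_of_phase
    refine ⟨fun q => by have := hs.bua q; cases q <;> exact this, hs.2, hs.3, hs.4, hs.5, hs.6,
        hs.7, fun _ => h2 (by simp [h]), by simp, by simp, fun ho' => absurd ho ho',
        fun ho' => absurd ho ho', hs.13⟩
  | calibrate y h h1 =>
    have h2 := hs.vOut_of_phase
    have := hs.sendAll (Msg.correctSymbol y) (by simp)
    refine ⟨fun q => by have := this.bua q; cases q <;> exact this, this.2, this.3, this.4, this.5,
      this.6, this.7, fun _ => h2 (by simp [h]), fun _ => by simp [NodeState.sendAll],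
      fun _ => ⟨y, fun j => Or.inr rfl⟩, this.11, fun ho' => absurd ho ho', this.13⟩
  | outputDecoded h h1 =>
    have h2 := hs.vOut_of_phase
    refine ⟨fun q => by have := hs.bua q; cases q <;> exact this, hs.2, hs.3, hs.4, hs.5, hs.6,
        hs.7, hs.8, hs.9, hs.10, by simp [h2, h], fun _ _ => Or.inr h, hs.13⟩
  | collectCorr j p h h1 h' h2 => exact hs.addCorr j p.2

theorem NodeState.relayed {i : Fin n} {s : NodeState A n k} (hq : Quiescent C t i s) {v : Bool}
    (h : t + 1 ≤ (s.readyFrom v).card) : ∃ j u, (j, Msg.ready u) ∈ s.sent := by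
  by_contra! h'
  exact hq _ (.readyRelay s v h h')

theorem Book.step (ht : 1 ≤ t) (hn : 3 * t + 1 ≤ n) {i : Fin n} {I : (Fin k → A) → Prop}
    {R : Fin n → Msg A → Prop} {O : Bool → Prop} {s s' : NodeState A n k}
    (hs : Book C t i s) (h : NodeStep C t i I R O s s') : Book C t i s' := by
  cases h with
  | act _ h ho => exact hs.localStep ht hn h ho
  | input w h hI =>
    refine ⟨fun q => ?_, rfl, hs.3, fun v hv j => Or.inl (hs.4 v hv j), fun j v h j' => Or.inl <|
      hs.5 j v (h.resolve_right fun h => by simp at h) j', fun v hv => (hs.6 v hv).imp fun j =>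
      Exists.imp fun u h => Or.inl h, hs.7, hs.8, hs.9, fun h => (hs.10 h).imp fun y h j =>
      Or.inl (h j), hs.11, hs.12, hs.13⟩
    have := (hs.bua q).mono (Y := s.sent ∪ {x | x.2 = Msg.symbol Inst.one (C.enc w x.1, C.enc w i)})
      Set.subset_union_left (fun _ _ h => h.resolve_right fun h => by simp at h)
    cases q with
    | two => exact this
    | one =>
      refine ⟨?_, this.2, this.3, this.4, by simp [NodeState.bua, NodeState.passInput,
        NodeState.setBua], this.6, this.7, this.8⟩
      rintro u hu j
      cases hu
      exact Or.inr rfl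
  | symbol j q p hR h =>
    have := hs.bua q
    exact hs.setBua_sent q _ ⟨this.1, this.2, this.3, this.4, this.5, this.6, this.7, this.8⟩
      (fun _ => rfl) (fun _ => rfl) (fun _ => rfl)
  | si1 j q c hR h =>
    have := hs.bua q
    exact hs.setBua_sent q _ ⟨this.1, this.2, this.3, this.4, this.5, this.6, this.7, this.8⟩
      (fun _ => rfl) (fun _ => rfl) (fun _ => rfl)
  | si2 j q c hR h =>
    have := hs.bua q
    refine hs.setBua_sent q _ ⟨this.1, this.2, this.3, this.4, this.5, this.6, ?_, this.8⟩
      (fun _ => rfl) (fun _ => rfl) (fun _ => rfl)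
    intro m r hm
    refine (this.7 m r hm).trans (Finset.card_le_card fun j' hj' => ?_)
    simp only [BUAState.set2, Finset.mem_filter, Finset.mem_univ, true_and] at hj' ⊢
    rw [Function.update_of_ne, hj']
    rintro rfl
    simp [h] at hj'
  | newSymbol j y hR h => exact hs.addNew j y
  | ready j v hR hq =>
    have hle : ∀ u, (s.readyFrom u).card ≤
        (Function.update s.readyFrom v (insert j (s.readyFrom v)) u).card := by
      intro u
      by_cases hu : u = v
      · subst hu
        simpa using Finset.card_le_card (Finset.subset_insert _ _)
      · rw [Function.update_of_ne hu]
    refine ⟨fun q => by have := hs.bua q; cases q <;> exact this, hs.2, hs.3, hs.4, hs.5, ?_,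
        fun u hu => (hs.7 u hu).trans (hle u), hs.8, hs.9, hs.10, hs.11, hs.12, hs.13⟩
    intro u hu
    by_cases huv : u = v
    · subst huv
      have := Finset.card_insert_le j (s.readyFrom u)
      simp only [Function.update_self] at hu
      -- A count of `t + 1` only enables the relay. The next message arrives in a quiescent state,
      -- by which time a `READY` has been sent; hence the bound `t + 2` in `Book.relay`.
      have h1 : t + 1 ≤ (s.readyFrom u).card := by omega
      have h2 : ∃ j u, (j, Msg.ready u) ∈ s.sent := NodeState.relayed hq h1
      exact h2
    · simp only [Function.update_of_ne huv] at hu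
      exact hs.relay u hu
  | correctSymbol j y hR h h2 => exact hs.addCorr j y
  | abba v h hO =>
    have := hs.sendAll (Msg.ready v) (by simp)
    refine ⟨fun q => by have := this.bua q; cases q <;> exact this, this.2, this.3, ?_, this.5,
      this.6, this.7, this.8, this.9, this.10, this.11, this.12, this.13⟩
    intro u hu j
    cases hu
    exact Or.inr rfl

theorem Execution.book (ht : 1 ≤ t) (hn : 3 * t + 1 ≤ n) (hk : 1 ≤ k) (E : Execution C t F) (T : ℕ)
    (i : Fin n) (hi : i ∉ F) : Book C t i (E.cfg T i) :=
  E.invariant (P := Book C t) (Book.initial hk)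
    (fun _ _ _ hi h hstep => (h _ hi).step ht hn hstep) T i hi

/-! ### Safety when all honest nodes start with the same message -/

/-- The messages that Node `i` may send to Node `j` if its message is `w`. -/
def MsgSafe (C : ECC A n k) (w : Fin k → A) (i j : Fin n) : Msg A → Prop
  | Msg.symbol _ p => p = (C.enc w j, C.enc w i)
  | Msg.si1 _ b => b = true
  | Msg.si2 _ b => b = true
  | Msg.newSymbol y => y = C.enc w i
  | Msg.ready _ => True
  | Msg.correctSymbol y => y = C.enc w i

structure BUASafe (C : ECC A n k) (F : Finset (Fin n)) (w : Fin k → A) (i : Fin n)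
    (b : BUAState A n k) : Prop where
  input : ∀ u, b.input = some u → u = w
  sym : ∀ j, j ∉ F → ∀ p, b.sym j = some p → p = (C.enc w i, C.enc w j)
  rs1 : ∀ j, j ∉ F → b.rs1 j ≠ some false
  rs2 : ∀ j, j ∉ F → b.rs2 j ≠ some false
  s1 : b.s1 ≠ some false
  s2 : b.s2 ≠ some false
  deliv : ∀ m r v, b.deliv = some (m, r, v) → v = true ∧ (r = some true → m = some w)

/-- Local states compatible with all honest nodes having the message `w`. -/
structure Safe (C : ECC A n k) (F : Finset (Fin n)) (w : Fin k → A) (i : Fin n)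
    (s : NodeState A n k) : Prop where
  bua : ∀ q, BUASafe C F w i (s.bua q)
  input : ∀ u, s.input = some u → u = w
  newSyms : ∀ j, j ∉ F → ∀ y, s.newSyms j = some y → y = C.enc w j
  corrSyms : ∀ j, j ∉ F → ∀ y, s.corrSyms j = some y → y = C.enc w j
  mtil : ∀ u, s.mtil = some u → u = w
  decoded : s.finDone = true → s.decoded = some w
  abbaIn : s.abbaIn ≠ some false
  sent : ∀ x ∈ s.sent, MsgSafe C w i x.1 x.2

theorem Safe.initial (w : Fin k → A) (i : Fin n) : Safe C F w i NodeState.initial := by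
  refine ⟨fun q => ?_, ?_, ?_, ?_, ?_, ?_, ?_, ?_⟩
  · rw [NodeState.initial_bua]
    constructor <;> simp [BUAState.initial]
  all_goals simp [NodeState.initial]

theorem BUASafe.links_false_subset {w : Fin k → A} {i : Fin n} {b : BUAState A n k}
    (h : BUASafe C F w i b) : b.links C i false ⊆ F := by
  intro j hj
  by_contra hjF
  simp only [BUAState.links, Finset.mem_filter, Finset.mem_univ, true_and] at hj
  obtain ⟨u, p, hu, hp, hup⟩ := hj
  obtain rfl := h.input u hu
  obtain rfl := h.sym j hjF p hp
  simp at hup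

theorem BUASafe.set1_false_subset {w : Fin k → A} {i : Fin n} {b : BUAState A n k}
    (h : BUASafe C F w i b) : b.set1 false ⊆ F := by
  intro j hj
  by_contra hjF
  simp only [BUAState.set1, Finset.mem_filter, Finset.mem_univ, true_and] at hj
  exact h.rs1 j hjF hj

theorem BUASafe.set2_false_subset {w : Fin k → A} {i : Fin n} {b : BUAState A n k}
    (h : BUASafe C F w i b) : b.set2 false ⊆ F := by
  intro j hj
  by_contra hjF
  simp only [BUAState.set2, Finset.mem_filter, Finset.mem_univ, true_and] at hj
  exact h.rs2 j hjF hj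

/-- One of the `t + 1` voters is honest, and its pair carries the correct `i`-th symbol. -/
theorem BUASafe.eq_enc_of_voters {w : Fin k → A} {i : Fin n} {b : BUAState A n k}
    (h : BUASafe C F w i b) (hF : F.card ≤ t) {y : A} {S : Finset (Fin n)} (hS : S ⊆ b.voters y)
    (hc : t + 1 ≤ S.card) : y = C.enc w i := by
  obtain ⟨j, hj, hjF⟩ := exists_honest hF hc
  have := hS hj
  simp only [BUAState.voters, Finset.mem_filter, Finset.mem_univ, true_and] at this
  obtain ⟨z, hz⟩ := this
  exact congrArg Prod.fst (h.sym j hjF _ hz)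

theorem update_eq_some {f : Fin n → Option A} {j : Fin n} {y : A} {P : Fin n → A → Prop}
    (hf : ∀ j, j ∉ F → ∀ y, f j = some y → P j y) (hj : j ∉ F → P j y) :
    ∀ l, l ∉ F → ∀ z, Function.update f j (some y) l = some z → P l z := by
  intro l hl z hz
  by_cases hlj : l = j
  · subst hlj
    rw [Function.update_self] at hz
    cases hz
    exact hj hl
  · rw [Function.update_of_ne hlj] at hz
    exact hf l hl z hz

theorem Safe.addNew (hF : F.card ≤ t) {w : Fin k → A} {i : Fin n} {s : NodeState A n k}
    (hs : Safe C F w i s) {j : Fin n} {y : A} (hy : j ∉ F → y = C.enc w j) :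
    Safe C F w i (s.addNew C t j y) := by
  obtain ⟨m, d, h, hm⟩ := s.addNew_eq C t j y
  have hr := update_eq_some hs.newSyms hy
  rw [h]
  refine ⟨fun q => by have := hs.bua q; cases q <;> exact this, hs.2, hr, hs.4, ?_, hs.6, hs.7, hs.8⟩
  rcases hm with rfl | ⟨hok, rfl⟩
  · exact hs.mtil
  · rintro u hu
    cases hu
    exact oecOK_sound hF hr hok

theorem Safe.addCorr (hF : F.card ≤ t) {w : Fin k → A} {i : Fin n} {s : NodeState A n k}
    (hs : Safe C F w i s) {j : Fin n} {y : A} (hy : j ∉ F → y = C.enc w j) :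
    Safe C F w i (s.addCorr C t j y) := by
  obtain ⟨d, f, h, hm⟩ := s.addCorr_eq C t j y
  have hr := update_eq_some hs.corrSyms hy
  rw [h]
  refine ⟨fun q => by have := hs.bua q; cases q <;> exact this, hs.2, hs.3, hr, hs.5, ?_, hs.7, hs.8⟩
  rcases hm with ⟨rfl, rfl, -⟩ | ⟨-, hok, rfl⟩
  · exact hs.decoded
  · exact fun _ => congrArg some (oecOK_sound hF hr hok)

theorem Safe.setBua {w : Fin k → A} {i : Fin n} {s : NodeState A n k} (hs : Safe C F w i s)
    (q : Inst) {b : BUAState A n k} (hb : BUASafe C F w i b) : Safe C F w i (s.setBua q b) := by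
  refine ⟨NodeState.forall_setBua (P := fun _ => BUASafe C F w i) hs.bua hb, ?_, ?_, ?_, ?_, ?_, ?_,
    ?_⟩ <;> cases q
  all_goals first | exact hs.2 | exact hs.3 | exact hs.4 | exact hs.5 | exact hs.6 | exact hs.7
                  | exact hs.8

theorem Safe.sendAll {w : Fin k → A} {i : Fin n} {s : NodeState A n k} (hs : Safe C F w i s)
    {m : Msg A} (hm : ∀ j, MsgSafe C w i j m) : Safe C F w i (s.sendAll m) := by
  refine ⟨fun q => by have := hs.bua q; cases q <;> exact this, hs.2, hs.3, hs.4, hs.5, hs.6, hs.7,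
    ?_⟩
  rintro x (hx | hx)
  · exact hs.sent x hx
  · rw [show x.2 = m from hx]
    exact hm _

theorem Safe.passInput {w : Fin k → A} {i : Fin n} {s : NodeState A n k} (hs : Safe C F w i s)
    (q : Inst) : Safe C F w i (s.passInput C i q w) := by
  have hb := hs.bua q
  have := hs.setBua q (b := { s.bua q with input := some w })
    ⟨fun u hu => (Option.some.inj hu).symm, hb.2, hb.3, hb.4, hb.5, hb.6, hb.7⟩
  refine ⟨fun q' => by have := this.bua q'; cases q' <;> exact this, this.2, this.3, this.4, this.5,
    this.6, this.7, ?_⟩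
  rintro ⟨j, m⟩ (hx | hx)
  · exact this.sent _ hx
  · rw [show m = Msg.symbol q (C.enc w j, C.enc w i) from hx]
    exact rfl

/-- Mismatching links and reported zeros come only from `F`, so rules that require `t + 1` of them
are never enabled. The majority rules send the correct symbol because their quorums contain an
honest node. -/
theorem Safe.localStep (hn : 3 * t + 1 ≤ n) (hF : F.card ≤ t) {w : Fin k → A} {i : Fin n}
    {s s' : NodeState A n k} (hs : Safe C F w i s) (hB : Book C t i s)
    (h : LocalStep C t i s s') : Safe C F w i s' := by
  cases h with
  | s1One q h h' =>
    have hb := hs.bua q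
    exact (hs.setBua q (b := { s.bua q with s1 := some true })
      ⟨hb.1, hb.2, hb.3, hb.4, by simp, hb.6, hb.7⟩).sendAll (m := Msg.si1 q true) fun _ => rfl
  | s1Zero q h h' =>
    have := Finset.card_le_card (hs.bua q).links_false_subset
    omega
  | s2Zero q h h' =>
    exfalso
    rcases h with h | h
    · exact (hs.bua q).s1 h
    · have := Finset.card_le_card (Finset.union_subset (hs.bua q).set1_false_subset
        (hs.bua q).links_false_subset)
      omega
  | s2One q h h1 h' =>
    have hb := hs.bua q
    exact (hs.setBua q (b := { s.bua q with s2 := some true })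
      ⟨hb.1, hb.2, hb.3, hb.4, hb.5, by simp, hb.7⟩).sendAll (m := Msg.si2 q true) fun _ => rfl
  | voteOne q h h' =>
    have hb := hs.bua q
    refine hs.setBua q ⟨hb.1, hb.2, hb.3, hb.4, hb.5, hb.6, ?_⟩
    intro m r v hm
    simp only [Option.some.injEq, Prod.mk.injEq] at hm
    obtain ⟨rfl, rfl, rfl⟩ := hm
    refine ⟨rfl, fun h2 => ?_⟩
    -- A vote may be cast before any input is present, but not with second indicator 1: this forces
    -- first indicator 1, hence a nonempty link set, hence an input.
    obtain ⟨u, hu⟩ := Option.ne_none_iff_exists'.mp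
      ((hB.bua q).input_of_s1 ((hB.bua q).s1_of_s2 h2))
    rw [hu, hb.input u hu]
  | voteZero q h h' =>
    have := Finset.card_le_card (hs.bua q).set2_false_subset
    omega
  | collectNew j p h h1 h' =>
    exact hs.addNew hF fun hj => congrArg Prod.snd ((hs.bua Inst.one).sym j hj p h)
  | majority y h h1 h2 h' =>
    have hy : y = C.enc w i :=
      (hs.bua Inst.one).eq_enc_of_voters hF subset_rfl
        ((show t + 1 ≤ n - 2 * t by omega).trans h1)
    have := hs.sendAll (m := Msg.newSymbol y) fun _ => hy
    exact ⟨fun q => by have := this.bua q; cases q <;> exact this, this.2, this.3, this.4, this.5,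
      this.6, this.7, this.8⟩
  | inputTwoOwn u h hw h' =>
    obtain rfl := hs.input u hw
    have : Safe C F u i { s with mtil := some u } :=
      ⟨fun q => by have := hs.bua q; cases q <;> exact this, hs.2, hs.3, hs.4,
        fun v hv => (Option.some.inj hv).symm, hs.6, hs.7, hs.8⟩
    exact this.passInput Inst.two
  | inputTwoDecoded u hw h' =>
    obtain rfl := hs.mtil u hw
    exact hs.passInput Inst.two
  | abbaFromTwo m r v h h' =>
    refine ⟨fun q => by have := hs.bua q; cases q <;> exact this, hs.2, hs.3, hs.4, hs.5, hs.6, ?_,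
      hs.8⟩
    simp [((hs.bua Inst.two).deliv m r v h).1]
  | abbaFromOne h h' =>
    exfalso
    rcases h with h | h
    · simp only [BUAState.vote, Option.map_eq_some_iff] at h
      obtain ⟨⟨m, r, v⟩, hd, hv⟩ := h
      have := ((hs.bua Inst.one).deliv m r v hd).1
      simp_all
    · exact (hs.bua Inst.one).s2 h
  | readyRelay v h h' => exact hs.sendAll fun _ => trivial
  | decideZero h h' =>
    exact ⟨fun q => by have := hs.bua q; cases q <;> exact this, hs.2, hs.3, hs.4, hs.5, hs.6, hs.7,
      hs.8⟩
  | decideOne h h' =>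
    exact ⟨fun q => by have := hs.bua q; cases q <;> exact this, hs.2, hs.3, hs.4, hs.5, hs.6, hs.7,
      hs.8⟩
  | outputDirect m v h h1 =>
    exact ⟨fun q => by have := hs.bua q; cases q <;> exact this, hs.2, hs.3, hs.4, hs.5, hs.6, hs.7,
      hs.8⟩
  | enterElse h h1 =>
    exact ⟨fun q => by have := hs.bua q; cases q <;> exact this, hs.2, hs.3, hs.4, hs.5, hs.6, hs.7,
      hs.8⟩
  | calibrate y h h1 =>
    have hy : y = C.enc w i :=
      (hs.bua Inst.two).eq_enc_of_voters (t := t) hF Finset.inter_subset_left h1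
    have := hs.sendAll (m := Msg.correctSymbol y) fun _ => hy
    exact ⟨fun q => by have := this.bua q; cases q <;> exact this, this.2, this.3, this.4, this.5,
      this.6, this.7, this.8⟩
  | outputDecoded h h1 =>
    exact ⟨fun q => by have := hs.bua q; cases q <;> exact this, hs.2, hs.3, hs.4, hs.5, hs.6, hs.7,
      hs.8⟩
  | collectCorr j p h h1 h' h2 =>
    exact hs.addCorr hF fun hj => congrArg Prod.snd ((hs.bua Inst.two).sym j hj p h)

theorem Safe.step (hn : 3 * t + 1 ≤ n) (hF : F.card ≤ t) {w : Fin k → A} {i : Fin n}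
    {I : (Fin k → A) → Prop} {R : Fin n → Msg A → Prop} {O : Bool → Prop}
    {s s' : NodeState A n k} (hs : Safe C F w i s) (hB : Book C t i s) (hI : ∀ u, I u → u = w)
    (hR : ∀ j m, R j m → j ∉ F → MsgSafe C w j i m) (h : NodeStep C t i I R O s s') :
    Safe C F w i s' := by
  cases h with
  | act _ h ho => exact hs.localStep hn hF hB h
  | input u h h' =>
    obtain rfl := hI u h'
    have : Safe C F u i { s with input := some u } :=
      ⟨fun q => by have := hs.bua q; cases q <;> exact this, fun v hv => (Option.some.inj hv).symm,
        hs.3, hs.4, hs.5, hs.6, hs.7, hs.8⟩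
    exact this.passInput Inst.one
  | symbol j q p h h' =>
    have hb := hs.bua q
    exact hs.setBua q ⟨hb.1, update_eq_some hb.2 fun hj => hR _ _ h hj, hb.3, hb.4, hb.5, hb.6, hb.7⟩
  | si1 j q c h h' =>
    have hb := hs.bua q
    refine hs.setBua q ⟨hb.1, hb.2, ?_, hb.4, hb.5, hb.6, hb.7⟩
    have := update_eq_some (F := F) (f := (s.bua q).rs1) (j := j) (y := c) (P := fun _ c => c ≠ false)
      (fun l hl d hd hdf => hb.3 l hl (hdf ▸ hd)) fun hj => by simp [show c = true from hR _ _ h hj]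
    exact fun l hl hd => this l hl _ hd rfl
  | si2 j q c h h' =>
    have hb := hs.bua q
    refine hs.setBua q ⟨hb.1, hb.2, hb.3, ?_, hb.5, hb.6, hb.7⟩
    have := update_eq_some (F := F) (f := (s.bua q).rs2) (j := j) (y := c) (P := fun _ c => c ≠ false)
      (fun l hl d hd hdf => hb.4 l hl (hdf ▸ hd)) fun hj => by simp [show c = true from hR _ _ h hj]
    exact fun l hl hd => this l hl _ hd rfl
  | newSymbol j y h h' => exact hs.addNew hF fun hj => hR _ _ h hj
  | ready j v h hq =>
    exact ⟨fun q => by have := hs.bua q; cases q <;> exact this, hs.2, hs.3, hs.4, hs.5, hs.6, hs.7,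
      hs.8⟩
  | correctSymbol j y h h' h2 => exact hs.addCorr hF fun hj => hR _ _ h hj
  | abba v h hO =>
    have := hs.sendAll (m := Msg.ready v) fun _ => trivial
    exact ⟨fun q => by have := this.bua q; cases q <;> exact this, this.2, this.3, this.4, this.5,
      this.6, this.7, this.8⟩

theorem Execution.safe (ht : 1 ≤ t) (hn : 3 * t + 1 ≤ n) (hk : 1 ≤ k) (hF : F.card ≤ t)
    (E : Execution C t F) {w : Fin k → A}
    (hI : ∀ T i u, i ∉ F → (E.cfg T i).input = some u → u = w) (T : ℕ) (i : Fin n) (hi : i ∉ F) :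
    Safe C F w i (E.cfg T i) :=
  E.invariant (P := Safe C F w) (Safe.initial w)
    (fun T i _ hi h hstep => (h i hi).step hn hF (E.book ht hn hk T i hi) (fun u => hI _ i u hi)
      (fun j _ hm hj => (h j hj).sent _ (hm hj)) hstep) T i hi

/-! ### Monotonicity and eventual quiescence -/

theorem NodeStep.input_eq {i : Fin n} {I : (Fin k → A) → Prop} {R : Fin n → Msg A → Prop}
    {O : Bool → Prop} {s s' : NodeState A n k} (h : NodeStep C t i I R O s s') {u : Fin k → A}
    (hu : s.input = some u) : s'.input = some u := by
  cases h with
  | act _ h ho =>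
    cases h with
    | s1One q | s1Zero q | s2Zero q | s2One q | voteOne q | voteZero q => cases q <;> exact hu
    | collectNew j p =>
      obtain ⟨m, d, h, -⟩ := s.addNew_eq C t j p.2
      rw [h]
      exact hu
    | collectCorr j p =>
      obtain ⟨m, d, h, -⟩ := s.addCorr_eq C t j p.2
      rw [h]
      exact hu
    | _ => exact hu
  | input w h => simp [h] at hu
  | symbol j q | si1 j q | si2 j q => cases q <;> exact hu
  | newSymbol j p =>
    obtain ⟨m, d, h, -⟩ := s.addNew_eq C t j p
    rw [h]
    exact hu
  | correctSymbol j p =>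
    obtain ⟨m, d, h, -⟩ := s.addCorr_eq C t j p
    rw [h]
    exact hu
  | _ => exact hu

theorem Execution.input_mono (E : Execution C t F) {i : Fin n} {u : Fin k → A} {T T' : ℕ}
    (hT : T ≤ T') (h : (E.cfg T i).input = some u) : (E.cfg T' i).input = some u := by
  induction T', hT using Nat.le_induction with
  | base => exact h
  | succ T' _ ih =>
    rcases E.nodeStep T' i with h' | h'
    · rw [h']; exact ih
    · exact h'.input_eq ih

/-! ### Finitely many set-once slots as a measure of progress -/

instance : Fintype Inst :=
  .ofEquiv Bool ⟨fun b => cond b .one .two, fun q => q.casesOn true false, fun b => by cases b <;> rfl,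
    fun q => by cases q <;> rfl⟩

/-- The variables of one unique agreement that are set at most once. -/
inductive BUASlot (n : ℕ)
  | input
  | sym (j : Fin n)
  | rs1 (j : Fin n)
  | rs2 (j : Fin n)
  | s1
  | s2
  | deliv
  deriving Fintype

/-- The items of a local state that are set at most once. -/
inductive Slot (n : ℕ)
  | bua (q : Inst) (x : BUASlot n)
  | newSym (j : Fin n)
  | maj
  | abbaIn
  | abbaOut
  | relay
  | ready (v : Bool) (j : Fin n)
  | vOut
  | phase (r : Fin 4)
  | corr (j : Fin n)
  | output
  deriving Fintype

def BUAState.filled (b : BUAState A n k) : BUASlot n → Prop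
  | .input => b.input ≠ none
  | .sym j => b.sym j ≠ none
  | .rs1 j => b.rs1 j ≠ none
  | .rs2 j => b.rs2 j ≠ none
  | .s1 => b.s1 ≠ none
  | .s2 => b.s2 ≠ none
  | .deliv => b.deliv ≠ none

def Phase.rank : Phase → Fin 4
  | .off => 0
  | .on => 1
  | .waitMajority => 2
  | .waitDecode => 3

/-- The clause for `corr` includes `finDone` because after a successful decoding further symbols are
ignored, yet receipt must still count as filling the slot. The phase is encoded by all ranks below
it, which makes it monotone. -/
def NodeState.filled (s : NodeState A n k) : Slot n → Prop
  | .bua q x => (s.bua q).filled x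
  | .newSym j => s.newSyms j ≠ none
  | .maj => s.maj ≠ none
  | .abbaIn => s.abbaIn ≠ none
  | .abbaOut => s.abbaOut ≠ none
  | .relay => ∃ j u, (j, Msg.ready u) ∈ s.sent
  | .ready v j => j ∈ s.readyFrom v
  | .vOut => s.vOut ≠ none
  | .phase r => r ≤ s.phase.rank
  | .corr j => s.corrSyms j ≠ none ∨ s.finDone = true
  | .output => s.output ≠ none

theorem update_ne_none {B : Type*} {f : Fin n → Option B} {j l : Fin n} {y : B}
    (h : f l ≠ none) : Function.update f j (some y) l ≠ none := by
  by_cases hl : l = j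
  · subst hl
    simp
  · rwa [Function.update_of_ne hl]

theorem NodeState.filled_setBua {s : NodeState A n k} {q : Inst} {b : BUAState A n k}
    (hb : ∀ x, (s.bua q).filled x → b.filled x) (x : Slot n) (hx : s.filled x) :
    (s.setBua q b).filled x := by
  cases x with
  | bua q' x =>
    cases q <;> cases q' <;> first | exact hb x hx | exact hx
  | _ => cases q <;> exact hx

theorem NodeState.filled_sent {s : NodeState A n k} {X : Set (Fin n × Msg A)} (hX : s.sent ⊆ X)
    (x : Slot n) (hx : s.filled x) : ({ s with sent := X } : NodeState A n k).filled x := by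
  cases x with
  | bua q' x => cases q' <;> exact hx
  | relay => exact hx.imp fun j => Exists.imp fun u h => hX h
  | _ => exact hx

theorem NodeState.filled_sendAll {s : NodeState A n k} {m : Msg A} (x : Slot n)
    (hx : s.filled x) : (s.sendAll m).filled x :=
  NodeState.filled_sent Set.subset_union_left x hx

theorem NodeState.filled_passInput {i : Fin n} {w : Fin k → A} {q : Inst} {s : NodeState A n k}
    (x : Slot n) (hx : s.filled x) : (s.passInput C i q w).filled x := by
  refine NodeState.filled_sent (s := s.setBua q { s.bua q with input := some w })
    Set.subset_union_left x (NodeState.filled_setBua (fun y hy => ?_) x hx)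
  cases y <;> first | exact hy | exact Option.some_ne_none _

theorem NodeState.filled_addNew {s : NodeState A n k} {j : Fin n} {y : A} (x : Slot n)
    (hx : s.filled x) : (s.addNew C t j y).filled x := by
  obtain ⟨m, d, h, -⟩ := s.addNew_eq C t j y
  rw [h]
  cases x with
  | bua q' x => cases q' <;> exact hx
  | newSym l => exact update_ne_none hx
  | _ => exact hx

theorem NodeState.filled_addCorr {s : NodeState A n k} {j : Fin n} {y : A} (x : Slot n)
    (hx : s.filled x) : (s.addCorr C t j y).filled x := by
  obtain ⟨d, f, h, hf⟩ := s.addCorr_eq C t j y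
  rw [h]
  cases x with
  | bua q' x => cases q' <;> exact hx
  | corr l =>
    refine hx.imp update_ne_none fun hd => ?_
    rcases hf with ⟨hf, -⟩ | ⟨hf, -⟩
    · exact hf.trans hd
    · exact hf
  | _ => exact hx

theorem NodeState.addNew_sent {s : NodeState A n k} {j : Fin n} {y : A} :
    (s.addNew C t j y).sent = s.sent := by
  obtain ⟨m, d, h, -⟩ := s.addNew_eq C t j y
  rw [h]

theorem NodeState.addCorr_sent {s : NodeState A n k} {j : Fin n} {y : A} :
    (s.addCorr C t j y).sent = s.sent := by
  obtain ⟨d, f, h, -⟩ := s.addCorr_eq C t j y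
  rw [h]

/-- Only the phase could move backwards, when `decideOne` sets it to `on`. At that moment `vOut` is
unset, so by `Book` the phase is still `off`. -/
theorem LocalStep.filled_mono {i : Fin n} {s s' : NodeState A n k} (hB : Book C t i s)
    (h : LocalStep C t i s s') (x : Slot n) (hx : s.filled x) : s'.filled x := by
  cases h with
  | s1One q h h' | s1Zero q h h' | s2Zero q h h' | s2One q h h1 h' =>
    refine NodeState.filled_sendAll x (NodeState.filled_setBua (fun y hy => ?_) x hx)
    cases y <;> first | exact hy | exact Option.some_ne_none _
  | voteOne q h h' | voteZero q h h' =>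
    refine NodeState.filled_setBua (fun y hy => ?_) x hx
    cases y <;> first | exact hy | exact Option.some_ne_none _
  | collectNew j p h h1 h' => exact NodeState.filled_addNew x hx
  | majority y h h1 h2 h' =>
    refine NodeState.filled_sendAll x ?_
    cases x with
    | bua q x => cases q <;> exact hx
    | maj => exact Option.some_ne_none _
    | _ => exact hx
  | inputTwoOwn w h hw h' =>
    refine NodeState.filled_passInput x ?_
    cases x with
    | bua q x => cases q <;> exact hx
    | _ => exact hx
  | inputTwoDecoded w hw h' => exact NodeState.filled_passInput x hx
  | readyRelay v h h' => exact NodeState.filled_sendAll x hx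
  | abbaFromTwo | abbaFromOne | decideZero | outputDirect | outputDecoded =>
    cases x with
    | bua q x => cases q <;> exact hx
    | _ => first | exact hx | exact Option.some_ne_none _
  | decideOne h h' =>
    have hp : s.phase = Phase.off := by
      by_contra hp
      exact absurd (h'.symm.trans (hB.vOut_of_phase hp)) (by simp)
    cases x with
    | bua q x => cases q <;> exact hx
    | phase r =>
      have : r ≤ s.phase.rank := hx
      rw [hp] at this
      exact this.trans (by decide : (0 : Fin 4) ≤ 1)
    | _ => first | exact hx | exact Option.some_ne_none _
  | enterElse h h1 =>
    cases x with
    | bua q x => cases q <;> exact hx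
    | phase r =>
      have : r ≤ s.phase.rank := hx
      rw [h] at this
      exact this.trans (by decide : (1 : Fin 4) ≤ 2)
    | _ => exact hx
  | calibrate y h h1 =>
    refine NodeState.filled_sendAll x ?_
    cases x with
    | bua q x => cases q <;> exact hx
    | phase r =>
      have : r ≤ s.phase.rank := hx
      rw [h] at this
      exact this.trans (by decide : (2 : Fin 4) ≤ 3)
    | _ => exact hx
  | collectCorr j p h h1 h' h2 => exact NodeState.filled_addCorr x hx

/-- The premise that prevents a handler from being repeated names the slot it fills; for the two
output rules it is that the node is still running. -/
theorem LocalStep.exists_filled {i : Fin n} {s s' : NodeState A n k}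
    (ho : s.output = none) (h : LocalStep C t i s s') : ∃ x, ¬ s.filled x ∧ s'.filled x := by
  cases h with
  | s1One q h h' | s1Zero q h h' =>
    refine ⟨.bua q .s1, not_not.mpr h', ?_⟩
    cases q <;> exact Option.some_ne_none _
  | s2Zero q h h' | s2One q h h1 h' =>
    refine ⟨.bua q .s2, not_not.mpr h', ?_⟩
    cases q <;> exact Option.some_ne_none _
  | voteOne q h h' | voteZero q h h' =>
    refine ⟨.bua q .deliv, not_not.mpr h', ?_⟩
    cases q <;> exact Option.some_ne_none _
  | collectNew j p h h1 h' =>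
    obtain ⟨m, d, h, -⟩ := s.addNew_eq C t j p.2
    refine ⟨.newSym j, not_not.mpr h', ?_⟩
    rw [h]
    simp [NodeState.filled]
  | majority y h h1 h2 h' => exact ⟨.maj, not_not.mpr h', Option.some_ne_none _⟩
  | inputTwoOwn w h hw h' => exact ⟨.bua .two .input, not_not.mpr h', Option.some_ne_none _⟩
  | inputTwoDecoded w hw h' => exact ⟨.bua .two .input, not_not.mpr h', Option.some_ne_none _⟩
  | abbaFromTwo m r v h h' => exact ⟨.abbaIn, not_not.mpr h', Option.some_ne_none _⟩
  | abbaFromOne h h' => exact ⟨.abbaIn, not_not.mpr h', Option.some_ne_none _⟩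
  | readyRelay v h h' => exact ⟨.relay, fun ⟨j, u, hj⟩ => h' j u hj, i, v, Or.inr rfl⟩
  | decideZero h h' => exact ⟨.vOut, not_not.mpr h', Option.some_ne_none _⟩
  | decideOne h h' => exact ⟨.vOut, not_not.mpr h', Option.some_ne_none _⟩
  | outputDirect m v h h1 => exact ⟨.output, not_not.mpr ho, Option.some_ne_none _⟩
  | enterElse h h1 => exact ⟨.phase 2, by simp [NodeState.filled, h, Phase.rank], le_refl (2 : Fin 4)⟩
  | calibrate y h h1 =>
    exact ⟨.phase 3, by simp [NodeState.filled, h, Phase.rank], le_refl (3 : Fin 4)⟩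
  | outputDecoded h h1 => exact ⟨.output, not_not.mpr ho, Option.some_ne_none _⟩
  | collectCorr j p h h1 h' h2 =>
    obtain ⟨d, f, h, -⟩ := s.addCorr_eq C t j p.2
    refine ⟨.corr j, by simp [NodeState.filled, h', h2], ?_⟩
    rw [h]
    simp [NodeState.filled]

theorem NodeStep.filled_mono {i : Fin n} {I : (Fin k → A) → Prop} {R : Fin n → Msg A → Prop}
    {O : Bool → Prop} {s s' : NodeState A n k} (hB : Book C t i s)
    (h : NodeStep C t i I R O s s') (x : Slot n) (hx : s.filled x) : s'.filled x := by
  cases h with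
  | act _ h ho => exact h.filled_mono hB x hx
  | input w h hI =>
    refine NodeState.filled_passInput x ?_
    cases x with
    | bua q x => cases q <;> exact hx
    | _ => exact hx
  | symbol j q p hR h | si1 j q c hR h | si2 j q c hR h =>
    refine NodeState.filled_setBua (fun y hy => ?_) x hx
    cases y <;> first | exact hy | exact update_ne_none hy
  | newSymbol j y hR h => exact NodeState.filled_addNew x hx
  | ready j v hR hq =>
    cases x with
    | bua q x => cases q <;> exact hx
    | ready u l =>
      change l ∈ Function.update s.readyFrom v (insert j (s.readyFrom v)) u
      by_cases hu : u = v
      · subst hu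
        rw [Function.update_self]
        exact Finset.mem_insert_of_mem hx
      · rw [Function.update_of_ne hu]
        exact hx
    | _ => exact hx
  | correctSymbol j y hR h h2 => exact NodeState.filled_addCorr x hx
  | abba v h hO =>
    refine NodeState.filled_sendAll x ?_
    cases x with
    | bua q x => cases q <;> exact hx
    | abbaOut => exact Option.some_ne_none _
    | _ => exact hx

theorem NodeStep.sent_mono {i : Fin n} {I : (Fin k → A) → Prop} {R : Fin n → Msg A → Prop}
    {O : Bool → Prop} {s s' : NodeState A n k} (h : NodeStep C t i I R O s s') :
    s.sent ⊆ s'.sent := by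
  cases h with
  | act _ h ho =>
    cases h with
    | s1One q | s1Zero q | s2Zero q | s2One q => cases q <;> exact Set.subset_union_left
    | voteOne q | voteZero q => cases q <;> exact subset_rfl
    | collectNew j p => exact NodeState.addNew_sent.symm.subset
    | collectCorr j p => exact NodeState.addCorr_sent.symm.subset
    | majority | readyRelay | inputTwoOwn | inputTwoDecoded | calibrate =>
      exact Set.subset_union_left
    | _ => exact subset_rfl
  | input | abba => exact Set.subset_union_left
  | symbol j q | si1 j q | si2 j q => cases q <;> exact subset_rfl
  | newSymbol j p => exact NodeState.addNew_sent.symm.subset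
  | correctSymbol j p => exact NodeState.addCorr_sent.symm.subset
  | ready => exact subset_rfl

theorem Execution.sent_mono (E : Execution C t F) (i : Fin n) {T T' : ℕ} (hT : T ≤ T') :
    (E.cfg T i).sent ⊆ (E.cfg T' i).sent := by
  induction T', hT using Nat.le_induction with
  | base => exact subset_rfl
  | succ T' _ ih =>
    rcases E.nodeStep T' i with h' | h'
    · rw [h']; exact ih
    · exact ih.trans h'.sent_mono

theorem Execution.filled_mono (ht : 1 ≤ t) (hn : 3 * t + 1 ≤ n) (hk : 1 ≤ k) (E : Execution C t F)
    {i : Fin n} (hi : i ∉ F) {x : Slot n} {T T' : ℕ} (hT : T ≤ T') (hx : (E.cfg T i).filled x) :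
    (E.cfg T' i).filled x := by
  induction T', hT using Nat.le_induction with
  | base => exact hx
  | succ T' _ ih =>
    rcases E.nodeStep T' i with h' | h'
    · rw [h']; exact ih
    · exact h'.filled_mono (E.book ht hn hk T' i hi) x ih

theorem Execution.eventually_filled (ht : 1 ≤ t) (hn : 3 * t + 1 ≤ n) (hk : 1 ≤ k)
    (E : Execution C t F) {i : Fin n} (hi : i ∉ F) {x : Slot n} {T : ℕ}
    (hx : (E.cfg T i).filled x) : ∀ᶠ T' in Filter.atTop, (E.cfg T' i).filled x :=
  Filter.eventually_atTop.mpr ⟨T, fun _ hT => E.filled_mono ht hn hk hi hT hx⟩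

/-- Every handler fills one of the finitely many slots, so a running node acts finitely often. -/
theorem Execution.eventually_quiescent (ht : 1 ≤ t) (hn : 3 * t + 1 ≤ n) (hk : 1 ≤ k)
    (E : Execution C t F) {i : Fin n} (hi : i ∉ F) (ho : ∀ T, (E.cfg T i).output = none) :
    ∀ᶠ T in Filter.atTop, Quiescent C t i (E.cfg T i) := by
  -- A slot is either never filled or filled from some time on. As there are finitely many, no slot
  -- changes after a common time, while any later action would fill one.
  have h1 : ∀ x : Slot n, ∀ᶠ T in Filter.atTop,
      (E.cfg (T + 1) i).filled x → (E.cfg T i).filled x := by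
    intro x
    by_cases hx : ∃ T, (E.cfg T i).filled x
    · obtain ⟨T, hx⟩ := hx
      exact (E.eventually_filled ht hn hk hi hx).mono fun _ h _ => h
    · exact .of_forall fun T h => absurd ⟨_, h⟩ hx
  obtain ⟨T, hT⟩ := Filter.eventually_atTop.mp (Filter.eventually_all.mpr h1)
  refine Filter.eventually_atTop.mpr ⟨T, fun T1 hT1 => ?_⟩
  by_contra hq
  obtain ⟨T2, hT2, he⟩ := E.progress T1 i hi (ho T1) hq
  have h := E.step T2
  rw [he] at h
  obtain ⟨-, -, s', hs, hc⟩ := h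
  obtain ⟨x, hx, hx'⟩ := hs.exists_filled (ho T2)
  refine hx (hT T2 (hT1.trans hT2) x ?_)
  rw [hc, Function.update_self]
  exact hx'

/-! ### Delivery of messages -/

/-- The slot filled by the receipt of a message from Node `j`. -/
def Msg.slot (j : Fin n) : Msg A → Slot n
  | .symbol q _ => .bua q (.sym j)
  | .si1 q _ => .bua q (.rs1 j)
  | .si2 q _ => .bua q (.rs2 j)
  | .newSymbol _ => .newSym j
  | .ready v => .ready v j
  | .correctSymbol _ => .corr j

theorem NodeState.filled_receive (s : NodeState A n k) (j : Fin n) (m : Msg A) :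
    (s.receive C t j m).filled (m.slot j) := by
  cases m <;> unfold NodeState.receive <;> dsimp only
  · rename_i q p
    split
    · cases q <;> simp [Msg.slot, NodeState.filled, BUAState.filled, NodeState.bua, NodeState.setBua]
    · simp_all [Msg.slot, NodeState.filled, BUAState.filled]
  · rename_i q p
    split
    · cases q <;> simp [Msg.slot, NodeState.filled, BUAState.filled, NodeState.bua, NodeState.setBua]
    · simp_all [Msg.slot, NodeState.filled, BUAState.filled]
  · rename_i q p
    split
    · cases q <;> simp [Msg.slot, NodeState.filled, BUAState.filled, NodeState.bua, NodeState.setBua]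
    · simp_all [Msg.slot, NodeState.filled, BUAState.filled]
  · rename_i y
    split
    · obtain ⟨m, d, h, -⟩ := s.addNew_eq C t j y
      simp [h, Msg.slot, NodeState.filled]
    · simp_all [Msg.slot, NodeState.filled]
  · simp [Msg.slot, NodeState.filled]
  · rename_i y
    split
    · obtain ⟨m, d, h, -⟩ := s.addCorr_eq C t j y
      simp [h, Msg.slot, NodeState.filled]
    · rename_i h
      simp only [Msg.slot, NodeState.filled]
      by_contra hc
      rw [not_or, not_not, Bool.not_eq_true] at hc
      exact h hc.1 hc.2

/-- The slot of a message records its sender and kind, but its content only for `READY`. In the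
other cases `Safe` tells what an honest sender can have put there. -/
theorem Execution.eventually_received (ht : 1 ≤ t) (hn : 3 * t + 1 ≤ n) (hk : 1 ≤ k)
    (E : Execution C t F) {i j : Fin n} (hi : i ∉ F) (hj : j ∉ F)
    (ho : ∀ T, (E.cfg T i).output = none) {m : Msg A} {T : ℕ} (hm : (i, m) ∈ (E.cfg T j).sent) :
    ∀ᶠ T' in Filter.atTop, (E.cfg T' i).filled (m.slot j) := by
  rcases E.delivery T i j m hi hj hm with ⟨T', he⟩ | ⟨T', h⟩
  · have h := E.step T'
    rw [he] at h
    refine E.eventually_filled ht hn hk hi (T := T' + 1) ?_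
    rw [h.2.2, Function.update_self]
    exact NodeState.filled_receive _ _ _
  · exact absurd (ho T') h

/-! ### Origin of the received messages -/

theorem NodeState.mem_of_sendAll {s : NodeState A n k} {m : Msg A} {x : Fin n × Msg A}
    (h : x ∈ (s.sendAll m).sent) (hm : x.2 ≠ m) : x ∈ s.sent :=
  h.resolve_right hm

theorem LocalStep.ready_sent {i : Fin n} {s s' : NodeState A n k} (h : LocalStep C t i s s')
    {j : Fin n} {v : Bool} (hv : (j, Msg.ready v) ∈ s'.sent) :
    (j, Msg.ready v) ∈ s.sent ∨ t + 1 ≤ (s.readyFrom v).card := by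
  cases h with
  | s1One q | s1Zero q | s2Zero q | s2One q =>
    left
    cases q <;> exact NodeState.mem_of_sendAll hv (by simp)
  | voteOne q | voteZero q => left; cases q <;> exact hv
  | collectNew => rw [NodeState.addNew_sent] at hv; exact Or.inl hv
  | collectCorr => rw [NodeState.addCorr_sent] at hv; exact Or.inl hv
  | majority | calibrate => exact Or.inl (NodeState.mem_of_sendAll hv (by simp))
  | inputTwoOwn | inputTwoDecoded => exact Or.inl (hv.resolve_right (by simp))
  | readyRelay u h h' =>
    rcases hv with hv | hv
    · exact Or.inl hv
    · cases hv
      exact Or.inr h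
  | _ => exact Or.inl hv

theorem LocalStep.readyFrom_eq {i : Fin n} {s s' : NodeState A n k} (h : LocalStep C t i s s') :
    s'.readyFrom = s.readyFrom := by
  cases h with
  | s1One q | s1Zero q | s2Zero q | s2One q | voteOne q | voteZero q => cases q <;> rfl
  | collectNew j p =>
    obtain ⟨m, d, h, -⟩ := s.addNew_eq C t j p.2
    rw [h]
  | collectCorr j p =>
    obtain ⟨m, d, h, -⟩ := s.addCorr_eq C t j p.2
    rw [h]
  | _ => rfl

theorem LocalStep.rs2_eq {i : Fin n} {s s' : NodeState A n k} (h : LocalStep C t i s s') (q : Inst) :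
    (s'.bua q).rs2 = (s.bua q).rs2 := by
  cases h with
  | s1One q' | s1Zero q' | s2Zero q' | s2One q' | voteOne q' | voteZero q' =>
    cases q <;> cases q' <;> rfl
  | collectNew j p =>
    obtain ⟨m, d, h, -⟩ := s.addNew_eq C t j p.2
    rw [h]
    cases q <;> rfl
  | collectCorr j p =>
    obtain ⟨m, d, h, -⟩ := s.addCorr_eq C t j p.2
    rw [h]
    cases q <;> rfl
  | _ => cases q <;> rfl

/-- `READY v` goes back to an honest output `v` of the binary agreement, and what was received from
honest nodes was sent by them. -/
structure Origin (E : Execution C t F) (i : Fin n) (s : NodeState A n k) : Prop where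
  ready_sent : ∀ j v, (j, Msg.ready v) ∈ s.sent → ∃ l, l ∉ F ∧ ∃ T, (E.cfg T l).abbaOut = some v
  readyFrom : ∀ v j, j ∉ F → j ∈ s.readyFrom v → ∃ T, (i, Msg.ready v) ∈ (E.cfg T j).sent
  readyFrom_abba : ∀ v j, j ∉ F → j ∈ s.readyFrom v →
    ∃ l, l ∉ F ∧ ∃ T, (E.cfg T l).abbaOut = some v
  rs2 : ∀ q j c, j ∉ F → (s.bua q).rs2 j = some c → ∃ T, (i, Msg.si2 q c) ∈ (E.cfg T j).sent

/-- A relayed `READY` has an honest predecessor among `t + 1` senders. The clause `readyFrom_abba`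
is carried along because the induction offers the sender's invariant only at the moment of receipt,
not at the unspecified time given by `readyFrom`. -/
theorem Execution.origin (hF : F.card ≤ t) (E : Execution C t F) (T : ℕ) (i : Fin n) (hi : i ∉ F) :
    Origin E i (E.cfg T i) := by
  refine E.invariant (P := Origin E) (fun i => ?_) (fun T i s' hi hP h => ?_) T i hi
  · constructor <;> simp [NodeState.initial_bua] <;> simp [NodeState.initial, BUAState.initial]
  have hs := hP i hi
  generalize hcfg : E.cfg T i = s at h hs
  cases h with
  | act _ h ho =>
    refine ⟨fun j v hv => ?_, ?_, ?_, fun q => ?_⟩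
    · rcases h.ready_sent hv with hv | hv
      · exact hs.ready_sent j v hv
      · obtain ⟨l, hl, hlF⟩ := exists_honest hF hv
        exact hs.readyFrom_abba v l hlF hl
    · rw [h.readyFrom_eq]
      exact hs.readyFrom
    · rw [h.readyFrom_eq]
      exact hs.readyFrom_abba
    · rw [h.rs2_eq]
      exact hs.rs2 q
  | input w h hI =>
    exact ⟨fun j v hv => hs.ready_sent j v (hv.resolve_right (by simp)), hs.2, hs.3,
      fun q => by have := hs.rs2 q; cases q <;> exact this⟩
  | symbol j q p hR h | si1 j q p hR h =>
    refine ⟨?_, ?_, ?_, NodeState.forall_setBua (P := fun q (b : BUAState A n k) => ∀ j c, j ∉ F →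
      b.rs2 j = some c → ∃ T, (i, Msg.si2 q c) ∈ (E.cfg T j).sent) hs.rs2 (hs.rs2 q)⟩ <;> cases q
    all_goals first | exact hs.1 | exact hs.2 | exact hs.3
  | si2 j q c hR h =>
    refine ⟨?_, ?_, ?_, NodeState.forall_setBua (P := fun q (b : BUAState A n k) => ∀ j c, j ∉ F →
      b.rs2 j = some c → ∃ T, (i, Msg.si2 q c) ∈ (E.cfg T j).sent) hs.rs2 ?_⟩
    · cases q <;> exact hs.1
    · cases q <;> exact hs.2
    · cases q <;> exact hs.3
    · intro l d hl hd
      exact update_eq_some (P := fun l d => ∃ T, (i, Msg.si2 q d) ∈ (E.cfg T l).sent)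
        (fun l hl d => hs.rs2 q l d hl) (fun hj => ⟨T, hR hj⟩) l hl d hd
  | newSymbol j y hR h =>
    obtain ⟨m, d, h, -⟩ := s.addNew_eq C t j y
    rw [h]
    exact ⟨hs.1, hs.2, hs.3, fun q => by have := hs.rs2 q; cases q <;> exact this⟩
  | ready j v hR hq =>
    have key : ∀ u l, l ∈ Function.update s.readyFrom v (insert j (s.readyFrom v)) u →
        l ∈ s.readyFrom u ∨ l = j ∧ u = v := by
      intro u l hl
      by_cases hu : u = v
      · subst hu
        rw [Function.update_self, Finset.mem_insert] at hl
        exact hl.symm.imp id fun h => ⟨h, rfl⟩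
      · rw [Function.update_of_ne hu] at hl
        exact Or.inl hl
    refine ⟨hs.1, fun u l hlF hl => ?_, fun u l hlF hl => ?_,
      fun q => by have := hs.rs2 q; cases q <;> exact this⟩
    · rcases key u l hl with hl | ⟨rfl, rfl⟩
      · exact hs.readyFrom u l hlF hl
      · exact ⟨T, hR hlF⟩
    · rcases key u l hl with hl | ⟨rfl, rfl⟩
      · exact hs.readyFrom_abba u l hlF hl
      · exact (hP l hlF).ready_sent _ _ (hR hlF)
  | correctSymbol j y hR h h2 =>
    obtain ⟨m, d, h, -⟩ := s.addCorr_eq C t j y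
    rw [h]
    exact ⟨hs.1, hs.2, hs.3, fun q => by have := hs.rs2 q; cases q <;> exact this⟩
  | abba v h hO =>
    refine ⟨fun j u hu => ?_, hs.2, hs.3, fun q => by have := hs.rs2 q; cases q <;> exact this⟩
    rcases hu with hu | hu
    · exact hs.ready_sent j u hu
    · cases hu
      exact ⟨i, hi, T + 1, hO⟩

/-! ### Quiescent states -/

theorem BUASafe.links_true_honest {w : Fin k → A} {i : Fin n} {b : BUAState A n k}
    (h : BUASafe C F w i b) (hin : b.input ≠ none) {j : Fin n} (hj : j ∉ F) (hsym : b.sym j ≠ none) :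
    j ∈ b.links C i true := by
  obtain ⟨u, hu⟩ := Option.ne_none_iff_exists'.mp hin
  obtain ⟨p, hp⟩ := Option.ne_none_iff_exists'.mp hsym
  simp only [BUAState.links, Finset.mem_filter, Finset.mem_univ, true_and, true_iff]
  refine ⟨u, p, hu, hp, ?_⟩
  rw [h.input u hu]
  exact h.sym j hj p hp

theorem BUASafe.mem_set1 {w : Fin k → A} {i : Fin n} {b : BUAState A n k}
    (h : BUASafe C F w i b) {j : Fin n} (hj : j ∉ F) (hr : b.rs1 j ≠ none) : j ∈ b.set1 true := by
  obtain ⟨c, hc⟩ := Option.ne_none_iff_exists'.mp hr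
  have := h.rs1 j hj
  cases c <;> simp_all [BUAState.set1]

theorem BUASafe.mem_set2 {w : Fin k → A} {i : Fin n} {b : BUAState A n k}
    (h : BUASafe C F w i b) {j : Fin n} (hj : j ∉ F) (hr : b.rs2 j ≠ none) : j ∈ b.set2 true := by
  obtain ⟨c, hc⟩ := Option.ne_none_iff_exists'.mp hr
  have := h.rs2 j hj
  cases c <;> simp_all [BUAState.set2]

theorem BUASafe.mem_voters {w : Fin k → A} {i : Fin n} {b : BUAState A n k}
    (h : BUASafe C F w i b) {j : Fin n} (hj : j ∉ F) (hsym : b.sym j ≠ none) :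
    j ∈ b.voters (C.enc w i) := by
  obtain ⟨p, hp⟩ := Option.ne_none_iff_exists'.mp hsym
  simp only [BUAState.voters, Finset.mem_filter, Finset.mem_univ, true_and]
  exact ⟨C.enc w j, by rw [hp, h.sym j hj p hp]⟩

/-- Pattern of the liveness lemmas: the honest nodes alone form a quorum of size `n - t`, so an
unset variable would leave a handler enabled; the value 0 is excluded by safety. -/
theorem Quiescent.s1_eq {w : Fin k → A} {i : Fin n} {s : NodeState A n k} (hF : F.card ≤ t)
    (hq : Quiescent C t i s) (hs : Safe C F w i s) {q : Inst} (hin : (s.bua q).input ≠ none)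
    (hsym : ∀ j, j ∉ F → (s.bua q).sym j ≠ none) : (s.bua q).s1 = some true := by
  have h1 := (hs.bua q).s1
  have h2 : (s.bua q).s1 ≠ none := fun h => hq _ <| .s1One s q
    (le_card_of_honest hF fun j hj => (hs.bua q).links_true_honest hin hj (hsym j hj)) h
  obtain ⟨c, hc⟩ := Option.ne_none_iff_exists'.mp h2
  cases c <;> simp_all

theorem Quiescent.s2_eq {w : Fin k → A} {i : Fin n} {s : NodeState A n k} (hF : F.card ≤ t)
    (hq : Quiescent C t i s) (hs : Safe C F w i s) {q : Inst} (hin : (s.bua q).input ≠ none)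
    (hsym : ∀ j, j ∉ F → (s.bua q).sym j ≠ none) (hr : ∀ j, j ∉ F → (s.bua q).rs1 j ≠ none) :
    (s.bua q).s2 = some true := by
  have h1 := (hs.bua q).s2
  have h2 : (s.bua q).s2 ≠ none := fun h => hq _ <| .s2One s q (hq.s1_eq hF hs hin hsym)
    (le_card_of_honest hF fun j hj => Finset.mem_inter.mpr ⟨(hs.bua q).mem_set1 hj (hr j hj),
      (hs.bua q).links_true_honest hin hj (hsym j hj)⟩) h
  obtain ⟨c, hc⟩ := Option.ne_none_iff_exists'.mp h2
  cases c <;> simp_all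

theorem Quiescent.deliv_ne {w : Fin k → A} {i : Fin n} {s : NodeState A n k} (hF : F.card ≤ t)
    (hq : Quiescent C t i s) (hs : Safe C F w i s) {q : Inst}
    (hr : ∀ j, j ∉ F → (s.bua q).rs2 j ≠ none) : (s.bua q).deliv ≠ none := fun h =>
  hq _ <| .voteOne s q (le_card_of_honest hF fun j hj => (hs.bua q).mem_set2 hj (hr j hj)) h

/-- In phase `on` one of the two branches is always enabled, and in `waitMajority` the hypothesis
`hy` enables `calibrate`. -/
theorem Quiescent.phase_eq {i : Fin n} {s : NodeState A n k} (hq : Quiescent C t i s)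
    (hB : Book C t i s) (hv : s.vOut = some true) {y : A}
    (hy : t + 1 ≤ (s.bua2.voters y ∩ s.bua2.set2 true).card) : s.phase = Phase.waitDecode := by
  rcases h : s.phase with _ | _ | _ | _
  · exact absurd h (hB.phase hv)
  · exfalso
    by_cases hd : ∃ m v, s.bua2.deliv = some (m, some true, v)
    · obtain ⟨m, v, hd⟩ := hd
      exact hq _ (.outputDirect s m v h hd)
    · push Not at hd
      exact hq _ (.enterElse s h hd)
  · exact absurd (.calibrate s y h hy) (hq _)
  · rfl

/-- Either decoding has succeeded and the output rule is enabled, or all honest symbols are present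
and correct, so the test run at the last addition would have succeeded. -/
theorem Quiescent.not_corr {w : Fin k → A} {i : Fin n} {s : NodeState A n k} (hF : F.card ≤ t)
    (hn : k + 2 * t ≤ n) (hq : Quiescent C t i s) (hs : Safe C F w i s) (hB : Book C t i s)
    (hp : s.phase = Phase.waitDecode) : ¬ ∀ j, j ∉ F → s.corrSyms j ≠ none ∨ s.finDone = true := by
  intro h
  by_cases hfin : s.finDone = true
  · exact hq _ (.outputDecoded s hp hfin)
  refine hB.finDone (by simpa using hfin) (oecOK_complete hF hn (w := w) fun j hj => ?_)
  obtain ⟨y, hy⟩ := Option.ne_none_iff_exists'.mp ((h j hj).resolve_right hfin)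
  rw [hy, hs.corrSyms j hj y hy]

/-! ### Executions with unanimous inputs -/

/-- An execution with correct binary agreement in which all honest nodes input `w`. -/
structure Unanimous (E : Execution C t F) (w : Fin k → A) : Prop where
  abba : ABBACorrect E
  t_pos : 1 ≤ t
  three_t_lt : 3 * t + 1 ≤ n
  k_pos : 1 ≤ k
  k_le : k + 2 * t ≤ n
  card_le : F.card ≤ t
  input : ∀ i, i ∉ F → ∃ T, (E.cfg T i).input = some w

namespace Unanimous

variable {E : Execution C t F} {w : Fin k → A} (H : Unanimous E w)

include H

theorem book (T : ℕ) {i : Fin n} (hi : i ∉ F) : Book C t i (E.cfg T i) :=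
  E.book H.t_pos H.three_t_lt H.k_pos T i hi

theorem safe (T : ℕ) {i : Fin n} (hi : i ∉ F) : Safe C F w i (E.cfg T i) := by
  refine E.safe H.t_pos H.three_t_lt H.k_pos H.card_le (fun T i u hi hu => ?_) T i hi
  obtain ⟨T', hw⟩ := H.input i hi
  have h1 := E.input_mono (le_max_left T T') hu
  have h2 := E.input_mono (le_max_right T T') hw
  exact Option.some.inj (h1.symm.trans h2)

theorem origin (T : ℕ) {i : Fin n} (hi : i ∉ F) : Origin E i (E.cfg T i) :=
  E.origin H.card_le T i hi

theorem eventually_quiescent {i : Fin n} (hi : i ∉ F) (ho : ∀ T, (E.cfg T i).output = none) :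
    ∀ᶠ T in Filter.atTop, Quiescent C t i (E.cfg T i) :=
  E.eventually_quiescent H.t_pos H.three_t_lt H.k_pos hi ho

theorem eventually_filled {i : Fin n} (hi : i ∉ F) {x : Slot n} {T : ℕ}
    (hx : (E.cfg T i).filled x) : ∀ᶠ T' in Filter.atTop, (E.cfg T' i).filled x :=
  E.eventually_filled H.t_pos H.three_t_lt H.k_pos hi hx

theorem eventually_received {i j : Fin n} (hi : i ∉ F) (hj : j ∉ F)
    (ho : ∀ T, (E.cfg T i).output = none) {m : Msg A} (hm : ∃ T, (i, m) ∈ (E.cfg T j).sent) :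
    ∀ᶠ T' in Filter.atTop, (E.cfg T' i).filled (m.slot j) :=
  hm.elim fun _ hm => E.eventually_received H.t_pos H.three_t_lt H.k_pos hi hj ho hm

theorem eventually_all_received {i : Fin n} (hi : i ∉ F) (ho : ∀ T, (E.cfg T i).output = none)
    {S : Finset (Fin n)} (hS : ∀ j ∈ S, j ∉ F) {m : Fin n → Msg A}
    (hm : ∀ j ∈ S, ∃ T, (i, m j) ∈ (E.cfg T j).sent) :
    ∀ᶠ T in Filter.atTop, ∀ j ∈ S, (E.cfg T i).filled ((m j).slot j) :=
  (Finset.eventually_all S).mpr fun j hj => H.eventually_received hi (hS j hj) ho (hm j hj)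

theorem eventually_honest_received {i : Fin n} (hi : i ∉ F) (ho : ∀ T, (E.cfg T i).output = none)
    {m : Fin n → Msg A} (hm : ∀ j, j ∉ F → ∃ T, (i, m j) ∈ (E.cfg T j).sent) :
    ∀ᶠ T in Filter.atTop, ∀ j, j ∉ F → (E.cfg T i).filled ((m j).slot j) :=
  (H.eventually_all_received hi ho (S := Fᶜ) (fun j hj => by simpa using hj)
    fun j hj => hm j (by simpa using hj)).mono fun T h j hj => h j (by simpa using hj)

theorem symbol_sent {q : Inst} {j : Fin n} (hj : j ∉ F) {T : ℕ}
    (hin : ((E.cfg T j).bua q).input ≠ none) (i : Fin n) :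
    (i, Msg.symbol q (C.enc w i, C.enc w j)) ∈ (E.cfg T j).sent := by
  obtain ⟨u, hu⟩ := Option.ne_none_iff_exists'.mp hin
  obtain rfl := ((H.safe T hj).bua q).input u hu
  exact ((H.book T hj).bua q).input u hu i

/-- If all honest nodes input a message to a unique agreement and none of them terminates, then they
all vote and succeed. -/
theorem eventually_success (ho : ∀ i, i ∉ F → ∀ T, (E.cfg T i).output = none) (q : Inst)
    (hin : ∀ i, i ∉ F → ∃ T, ((E.cfg T i).bua q).input ≠ none) (i : Fin n) (hi : i ∉ F) :
    ∀ᶠ T in Filter.atTop, ((E.cfg T i).bua q).s2 = some true ∧ ((E.cfg T i).bua q).deliv ≠ none := by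
  have hinput : ∀ i, i ∉ F → ∀ᶠ T in Filter.atTop, ((E.cfg T i).bua q).input ≠ none := fun i hi =>
    (hin i hi).elim fun T hT => H.eventually_filled hi (x := .bua q .input) hT
  have hsym : ∀ i, i ∉ F → ∀ᶠ T in Filter.atTop, ∀ j, j ∉ F → ((E.cfg T i).bua q).sym j ≠ none :=
    fun i hi => H.eventually_honest_received hi (ho i hi)
      (m := fun j => Msg.symbol q (C.enc w i, C.enc w j))
      fun j hj => (hin j hj).imp fun T hT => H.symbol_sent hj hT i
  have hs1 : ∀ i, i ∉ F → ∃ T, ((E.cfg T i).bua q).s1 = some true := fun i hi =>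
    ((H.eventually_quiescent hi (ho i hi)).and ((hinput i hi).and (hsym i hi))).exists.imp
      fun T hT => hT.1.s1_eq H.card_le (H.safe T hi) hT.2.1 hT.2.2
  have hr1 : ∀ i, i ∉ F → ∀ᶠ T in Filter.atTop, ∀ j, j ∉ F → ((E.cfg T i).bua q).rs1 j ≠ none :=
    fun i hi => H.eventually_honest_received hi (ho i hi) (m := fun _ => Msg.si1 q true)
      fun j hj => (hs1 j hj).imp fun T hT => ((H.book T hj).bua q).s1 true hT i
  have hs2 : ∀ i, i ∉ F → ∀ᶠ T in Filter.atTop, ((E.cfg T i).bua q).s2 = some true :=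
    fun i hi => by
      filter_upwards [H.eventually_quiescent hi (ho i hi), hinput i hi, hsym i hi, hr1 i hi]
        with T hq h1 h2 h3 using hq.s2_eq H.card_le (H.safe T hi) h1 h2 h3
  have hr2 : ∀ᶠ T in Filter.atTop, ∀ j, j ∉ F → ((E.cfg T i).bua q).rs2 j ≠ none :=
    H.eventually_honest_received hi (ho i hi) (m := fun _ => Msg.si2 q true)
      fun j hj => (hs2 j hj).exists.imp fun T hT => ((H.book T hj).bua q).s2 true hT i
  filter_upwards [H.eventually_quiescent hi (ho i hi), hs2 i hi, hr2] with T hq h1 h2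
  exact ⟨h1, hq.deliv_ne H.card_le (H.safe T hi) h2⟩

theorem eventually_input (i : Fin n) (hi : i ∉ F) :
    ∀ᶠ T in Filter.atTop, (E.cfg T i).input = some w :=
  (H.input i hi).elim fun T hT =>
    Filter.eventually_atTop.mpr ⟨T, fun _ hTT => E.input_mono hTT hT⟩

/-- While nobody terminates, success of the first agreement makes every honest node pass an input to
the second, and the vote of the second supplies an ABBA input. -/
theorem exists_abbaOut (ho : ∀ i, i ∉ F → ∀ T, (E.cfg T i).output = none) (i : Fin n) (hi : i ∉ F) :
    ∃ T, (E.cfg T i).abbaOut ≠ none := by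
  refine H.abba.termination (fun i hi => ?_) ho i hi
  have h1 : ∀ i, i ∉ F → ∃ T, ((E.cfg T i).bua Inst.one).input ≠ none := fun i hi =>
    (H.input i hi).imp fun T hT => by
      rw [show ((E.cfg T i).bua Inst.one).input = _ from (H.book T hi).input, hT]
      simp
  have h2 : ∀ i, i ∉ F → ∃ T, ((E.cfg T i).bua Inst.two).input ≠ none := fun i hi => by
    obtain ⟨T, hq, hs, hin⟩ := ((H.eventually_quiescent hi (ho i hi)).and
      ((H.eventually_success ho Inst.one h1 i hi).and (H.eventually_input i hi))).exists
    exact ⟨T, fun h => hq _ (.inputTwoOwn _ w hs.1 hin h)⟩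
  obtain ⟨T, hq, hs⟩ := ((H.eventually_quiescent hi (ho i hi)).and
    (H.eventually_success ho Inst.two h2 i hi)).exists
  obtain ⟨⟨m, r, v⟩, hd⟩ := Option.ne_none_iff_exists'.mp hs.2
  exact ⟨T, fun h => hq _ (.abbaFromTwo _ m r v hd h)⟩

/-! ### Only the value 1 circulates, and only `w` is output -/

theorem abbaOut_eq {i : Fin n} (hi : i ∉ F) {T : ℕ} {v : Bool}
    (h : (E.cfg T i).abbaOut = some v) : v = true :=
  H.abba.validity true (fun _ hi T => (H.safe T hi).abbaIn) i hi T v h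

theorem ready_eq {i j : Fin n} (hi : i ∉ F) {T : ℕ} {v : Bool}
    (h : (j, Msg.ready v) ∈ (E.cfg T i).sent) : v = true := by
  obtain ⟨l, hl, T', h'⟩ := (H.origin T hi).ready_sent j v h
  exact H.abbaOut_eq hl h'

theorem exists_honest_ready {i : Fin n} (hi : i ∉ F) {T : ℕ} {v : Bool}
    (h : t + 1 ≤ ((E.cfg T i).readyFrom v).card) :
    ∃ j, j ∉ F ∧ ∃ T, (i, Msg.ready v) ∈ (E.cfg T j).sent := by
  obtain ⟨j, hj, hjF⟩ := exists_honest H.card_le h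
  exact ⟨j, hjF, (H.origin T hi).readyFrom v j hjF hj⟩

theorem readyFrom_eq {i : Fin n} (hi : i ∉ F) {T : ℕ} {v : Bool}
    (h : t + 1 ≤ ((E.cfg T i).readyFrom v).card) : v = true := by
  obtain ⟨j, hj, T', hT⟩ := H.exists_honest_ready hi h
  exact H.ready_eq hj hT

theorem vOut_eq {i : Fin n} (hi : i ∉ F) {T : ℕ} (h : (E.cfg T i).vOut ≠ none) :
    (E.cfg T i).vOut = some true := by
  obtain ⟨v, hv⟩ := Option.ne_none_iff_exists'.mp h
  have h1 := (H.book T hi).vOut v hv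
  have h2 : v = true := H.readyFrom_eq hi (T := T) (by omega)
  rw [hv, h2]

theorem output_eq {i : Fin n} (hi : i ∉ F) (T : ℕ) :
    ∀ m, (E.cfg T i).output = some m → m = some w := by
  refine E.invariant (P := fun i s => ∀ m, s.output = some m → m = some w) (fun i => ?_)
    (fun T i s' hi hP h => ?_) T i hi
  · simp [NodeState.initial]
  have hp := hP i hi
  have hs := H.safe T hi
  cases h with
  | act _ h ho =>
    cases h with
    | s1One q | s1Zero q | s2Zero q | s2One q | voteOne q | voteZero q => cases q <;> exact hp
    | collectNew j p =>
      obtain ⟨m, d, h, -⟩ := (E.cfg T i).addNew_eq C t j p.2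
      rw [h]
      exact hp
    | collectCorr j p =>
      obtain ⟨m, d, h, -⟩ := (E.cfg T i).addCorr_eq C t j p.2
      rw [h]
      exact hp
    | decideZero h =>
      exact absurd (H.readyFrom_eq hi (T := T) (v := false) (by omega)) (by simp)
    | outputDirect m v h h1 =>
      rintro m' hm
      cases hm
      exact ((hs.bua Inst.two).deliv m _ v h1).2 rfl
    | outputDecoded h h1 =>
      rintro m' hm
      cases hm
      exact hs.decoded h1
    | _ => exact hp
  | symbol j q | si1 j q | si2 j q => cases q <;> exact hp
  | newSymbol j y =>
    obtain ⟨m, d, h, -⟩ := (E.cfg T i).addNew_eq C t j y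
    rw [h]
    exact hp
  | correctSymbol j y =>
    obtain ⟨m, d, h, -⟩ := (E.cfg T i).addCorr_eq C t j y
    rw [h]
    exact hp
  | _ => exact hp

/-- Once an honest node outputs, all honest nodes send `READY 1`. -/
theorem ready_sent_of_output {i₀ : Fin n} (hi₀ : i₀ ∉ F) {T₀ : ℕ}
    (h₀ : (E.cfg T₀ i₀).output ≠ none) (i : Fin n) (hi : i ∉ F) :
    ∃ T, ∀ j, (j, Msg.ready true) ∈ (E.cfg T i).sent := by
  have hcard : ∀ i, i ∉ F → ∀ T, (E.cfg T i).output ≠ none →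
      2 * t + 1 ≤ ((E.cfg T i).readyFrom true).card := fun i hi T h =>
    (H.book T hi).vOut true (H.vOut_eq hi ((H.book T hi).vOut_of_output h))
  have conclude : ∀ T, (∃ j u, (j, Msg.ready u) ∈ (E.cfg T i).sent) →
      ∃ T, ∀ j, (j, Msg.ready true) ∈ (E.cfg T i).sent := by
    rintro T ⟨j, u, hu⟩
    obtain rfl := H.ready_eq hi hu
    exact ⟨T, (H.book T hi).ready j _ hu⟩
  by_cases ho : ∃ T, (E.cfg T i).output ≠ none
  · obtain ⟨T, ho⟩ := ho
    -- A node that has output counted `2 * t + 1 ≥ t + 2` senders of `READY 1`, so it sent its own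
    -- before terminating.
    refine conclude T ((H.book T hi).relay true ?_)
    have := hcard i hi T ho
    have := H.t_pos
    omega
  · push Not at ho
    have h1 := hcard i₀ hi₀ T₀ h₀
    have h2 := Finset.le_card_sdiff F ((E.cfg T₀ i₀).readyFrom true)
    -- The at least `t + 1` honest nodes that sent `READY 1` to `i₀` sent it to everybody, so they
    -- reach the running node `i` and trigger its relay.
    have h3 := H.eventually_all_received hi ho (S := (E.cfg T₀ i₀).readyFrom true \ F)
      (fun j hj => (Finset.mem_sdiff.mp hj).2) (m := fun _ => Msg.ready true) fun j hj => by
        rw [Finset.mem_sdiff] at hj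
        obtain ⟨T, hT⟩ := (H.origin T₀ hi₀).readyFrom true j hj.2 hj.1
        exact ⟨T, (H.book T hj.2).ready _ _ hT i⟩
    obtain ⟨T, hq, hT⟩ := ((H.eventually_quiescent hi ho).and h3).exists
    refine conclude T (NodeState.relayed hq (v := true) ?_)
    have h4 := Finset.card_le_card (show (E.cfg T₀ i₀).readyFrom true \ F ⊆
      (E.cfg T i).readyFrom true from hT)
    have := H.card_le
    omega

/-- If no honest node had input 1, validity would allow only the output 0, contradicting
`abbaOut_eq`. -/
theorem exists_abbaIn {i : Fin n} (hi : i ∉ F) {T : ℕ} {v : Bool}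
    (h : (E.cfg T i).abbaOut = some v) : ∃ j, j ∉ F ∧ ∃ T, (E.cfg T j).abbaIn = some true := by
  by_contra! hc
  have h1 := H.abba.validity false (fun j hj T => hc j hj T) i hi T v h
  have h2 := H.abbaOut_eq hi h
  simp_all

theorem eventually_success_received {i j : Fin n} (hi : i ∉ F) (hj : j ∉ F)
    (ho : ∀ T, (E.cfg T i).output = none) {q : Inst} {T : ℕ}
    (hs2 : ((E.cfg T j).bua q).s2 = some true) :
    ∀ᶠ T in Filter.atTop, ((E.cfg T i).bua q).sym j ≠ none ∧ ((E.cfg T i).bua q).rs2 j ≠ none := by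
  have hb := (H.book T hj).bua q
  exact (H.eventually_received hi hj ho
      ⟨T, H.symbol_sent hj (hb.input_of_s1 (hb.s1_of_s2 hs2)) i⟩).and
    (H.eventually_received hi hj ho ⟨T, hb.s2 true hs2 i⟩)

/-- A node that never outputs reaches the last phase if all honest nodes send `READY 1`. -/
theorem eventually_waitDecode (hR : ∀ j, j ∉ F → ∃ T, ∀ l, (l, Msg.ready true) ∈ (E.cfg T j).sent)
    {i : Fin n} (hi : i ∉ F) (ho : ∀ T, (E.cfg T i).output = none) :
    ∀ᶠ T in Filter.atTop, (E.cfg T i).phase = Phase.waitDecode := by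
  -- `READY 1` is traced back to an honest ABBA output, then to an honest ABBA input 1, then to a
  -- vote 1 at some honest `l'`. The honest part `S` of that voter's quorum has at least `n - 2 * t
  -- ≥ t + 1` members.
  obtain ⟨T₁, hT₁⟩ := hR i hi
  obtain ⟨l, hl, T₂, hT₂⟩ := (H.origin T₁ hi).ready_sent i true (hT₁ i)
  obtain ⟨l', hl', T₃, hT₃⟩ := H.exists_abbaIn hl hT₂
  obtain ⟨m, r, hd⟩ := (H.book T₃ hl').abbaIn hT₃
  have hc := ((H.book T₃ hl').bua Inst.two).deliv_set2 m r hd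
  set S := ((E.cfg T₃ l').bua Inst.two).set2 true \ F with hS
  have hSc : _ ≤ S.card := Finset.le_card_sdiff F (((E.cfg T₃ l').bua Inst.two).set2 true)
  have hrec : ∀ᶠ T in Filter.atTop, ∀ j ∈ S, ((E.cfg T i).bua Inst.two).sym j ≠ none ∧
      ((E.cfg T i).bua Inst.two).rs2 j ≠ none := by
    refine (Finset.eventually_all S).mpr fun j hj => ?_
    rw [hS, Finset.mem_sdiff] at hj
    obtain ⟨hj, hjF⟩ := hj
    simp only [BUAState.set2, Finset.mem_filter, Finset.mem_univ, true_and] at hj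
    obtain ⟨T, hT⟩ := (H.origin T₃ hl').rs2 _ j _ hjF hj
    exact H.eventually_success_received hi hjF ho
      -- An honest sender of the indicator 1 had an input, so its symbols were sent to `i` as well.
      (((H.book T hjF).bua Inst.two).s2_of_sent _ _ hT)
  filter_upwards [H.eventually_quiescent hi ho, hrec, H.eventually_honest_received hi ho
    (m := fun _ => Msg.ready true) fun j hj => (hR j hj).imp fun T h => h i] with T hq hr hready
  have hs := (H.safe T hi).bua Inst.two
  have hsub : S ⊆ (E.cfg T i).bua2.voters (C.enc w i) ∩ (E.cfg T i).bua2.set2 true := fun j hj =>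
    have hjF := (Finset.mem_sdiff.mp hj).2
    Finset.mem_inter.mpr ⟨hs.mem_voters hjF (hr j hj).1, hs.mem_set2 hjF (hr j hj).2⟩
  have h1 := H.three_t_lt
  have h2 := H.card_le
  refine hq.phase_eq (H.book T hi) (H.vOut_eq hi fun hv => hq _ (.decideOne _ ?_ hv))
    (le_trans (by omega) (Finset.card_le_card hsub))
  have : n - t ≤ ((E.cfg T i).readyFrom true).card := le_card_of_honest h2 hready
  omega

/-- A node that never outputs would wait for decoding forever, although the symbols of all honest
nodes reach it. -/
theorem exists_output_of_ready
    (hR : ∀ j, j ∉ F → ∃ T, ∀ l, (l, Msg.ready true) ∈ (E.cfg T j).sent) (i : Fin n) (hi : i ∉ F) :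
    ∃ T, (E.cfg T i).output ≠ none := by
  by_contra! ho
  have hcorr : ∀ j ∈ Fᶜ, ∀ᶠ T in Filter.atTop,
      (E.cfg T i).corrSyms j ≠ none ∨ (E.cfg T i).finDone = true := by
    intro j hj
    replace hj : j ∉ F := by simpa using hj
    -- Terminated or not, node `j` at some time has second indicator 1, so that its `SYMBOL` pair is
    -- usable, or has sent `CORRECTSYMBOL`.
    have h : ∃ T, ((E.cfg T j).bua Inst.two).s2 = some true ∨
        (E.cfg T j).phase = Phase.waitDecode := by
      by_cases hoj : ∃ T, (E.cfg T j).output ≠ none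
      · obtain ⟨T, hoj⟩ := hoj
        have hB := H.book T hj
        exact ⟨T, hB.output hoj (H.vOut_eq hj (hB.vOut_of_output hoj))⟩
      · push Not at hoj
        exact (H.eventually_waitDecode hR hj hoj).exists.imp fun T h => Or.inr h
    obtain ⟨T, h | h⟩ := h
    · filter_upwards [H.eventually_quiescent hi ho, H.eventually_success_received hi hj ho h]
        with T hq hT
      by_contra hc
      rw [not_or, not_not, Bool.not_eq_true] at hc
      obtain ⟨p, hp⟩ := Option.ne_none_iff_exists'.mp hT.1
      exact hq _ (.collectCorr _ j p hp (((H.safe T hi).bua Inst.two).mem_set2 hj hT.2) hc.1 hc.2)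
    · obtain ⟨y, hy⟩ := (H.book T hj).waitDecode h
      exact H.eventually_received hi hj ho ⟨T, hy i⟩
  obtain ⟨T, hq, hp, hc⟩ := ((H.eventually_quiescent hi ho).and
    ((H.eventually_waitDecode hR hi ho).and ((Finset.eventually_all Fᶜ).mpr hcorr))).exists
  exact hq.not_corr H.card_le H.k_le (H.safe T hi) (H.book T hi) hp
    fun j hj => hc j (by simpa using hj)

theorem exists_output (i : Fin n) (hi : i ∉ F) : ∃ T, (E.cfg T i).output ≠ none := by
  by_cases h : ∃ i, i ∉ F ∧ ∃ T, (E.cfg T i).output ≠ none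
  · obtain ⟨i₀, hi₀, T₀, h₀⟩ := h
    exact H.exists_output_of_ready (H.ready_sent_of_output hi₀ h₀) i hi
  · push Not at h
    refine H.exists_output_of_ready (fun j hj => ?_) i hi
    obtain ⟨T, hT⟩ := H.exists_abbaOut h j hj
    obtain ⟨v, hv⟩ := Option.ne_none_iff_exists'.mp hT
    obtain rfl := H.abbaOut_eq hj hv
    exact ⟨T, (H.book T hj).abbaOut _ hv⟩

/-- ABBA guarantees no output once nodes terminate, so the claim is read off backwards from an
honest output via the `READY` messages that caused it. -/
theorem exists_abbaOut_true : ∃ i, i ∉ F ∧ ∃ T, (E.cfg T i).abbaOut = some true := by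
  have hn := H.three_t_lt
  obtain ⟨i, -, hi⟩ := exists_honest (S := Finset.univ) H.card_le
    (by rw [Finset.card_univ, Fintype.card_fin]; omega)
  obtain ⟨T, hT⟩ := H.exists_output i hi
  have hv := (H.book T hi).vOut true (H.vOut_eq hi ((H.book T hi).vOut_of_output hT))
  obtain ⟨j, hj, T', hT'⟩ := H.exists_honest_ready hi (T := T) (v := true) (by omega)
  exact (H.origin T' hj).ready_sent i true hT'

end Unanimous

end ACOOL

end

/-! ### The main theorem -/

theorem theorem2 {A : Type*} (n t k : ℕ) (hn : 3 * t + 1 ≤ n) (hk : 1 ≤ k) (hkt : 3 * k ≤ t + 2)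
    (C : ACOOL.ECC A n k) (F : Finset (Fin n)) (hF : F.card ≤ t)
    (E : ACOOL.Execution C t F) (hABBA : ACOOL.ABBACorrect E)
    (w : Fin k → A) (hw : ∀ i, i ∉ F → ∃ T, (E.cfg T i).input = some w) :
    (∀ i, i ∉ F → ∃ T, (E.cfg T i).output = some (some w)) ∧
    (∀ i, i ∉ F → ∀ T q, ((E.cfg T i).bua q).s1 ≠ some false ∧
      ((E.cfg T i).bua q).s2 ≠ some false ∧ ((E.cfg T i).bua q).vote ≠ some false) ∧
    (∀ i, i ∉ F → ∀ T u, (E.cfg T i).bua2.input = some u → u = w) ∧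
    ((∃ i, i ∉ F ∧ ∃ T, (E.cfg T i).abbaOut = some true) ∧
      ∀ i, i ∉ F → ∀ T, (E.cfg T i).abbaOut ≠ some false) := by
  -- From `1 ≤ k` and `3 * k ≤ t + 2` follow `1 ≤ t` and `k ≤ t`, hence `k + 2 * t ≤ 3 * t < n`.
  have H : ACOOL.Unanimous E w := ⟨hABBA, by omega, hn, hk, by omega, hF, hw⟩
  refine ⟨fun i hi => ?_, fun i hi T q => ?_, fun i hi T u => ((H.safe T hi).bua .two).input u,
    H.exists_abbaOut_true, fun i hi T h => absurd (H.abbaOut_eq hi h) (by simp)⟩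
  · obtain ⟨T, hT⟩ := H.exists_output i hi
    obtain ⟨m, hm⟩ := Option.ne_none_iff_exists'.mp hT
    exact ⟨T, by rw [hm, H.output_eq hi T m hm]⟩
  · have hs := (H.safe T hi).bua q
    refine ⟨hs.s1, hs.s2, fun h => ?_⟩
    simp only [ACOOL.BUAState.vote, Option.map_eq_some_iff] at h
    obtain ⟨⟨m, r, v⟩, hd, rfl⟩ := h
    exact absurd (hs.deliv m r _ hd).1 (by simp)
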